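/- **Setting.** A valued field is a field $K$ with a valuation ring $\mathcal O_K\subsetneq K$ (Krull valuations of arbitrary rank are allowed); it is of equi-characteristic $0$ if its residue field (hence also $K$) has characteristic $0$. Write $|\cdot|\colon K\to\Gamma_K=\Gamma_K^\times\cup\{0\}$ for the valuation, in multiplicative notation. For $\lambda\le 1$ in $\Gamma_K^\times$ let $\mathrm{RV}_\lambda=K^\times/\{x : |x-1|<\lambda\}\cup\{0\}$, let $\mathrm{rv}_\lambda\colon K\to \mathrm{RV}_\lambda$ be the natural map with $\mathrm{rv}_\lambda(0)=0$, and set $\mathrm{RV}=\mathrm{RV}_1$. A *ball* is an infinite set $B\subsetneq K$ such that for all $x,x'\in B$ and $y\in K$ with $|x-y|\le|x-x'|$ one has $y\in B$. An *open ball* is a set $\{x\in K : |x-a|<\gamma\}$ with $a\in K$, $\gamma\in\Gamma_K^\times$. A ball is *$\lambda$-next to* $c\in K$ if it is of the form $\{x\in K : \mathrm{rv}_\lambda(x-c)=\xi\}$ with $\xi\in \mathrm{RV}_\lambda\setminus\{0\}$, and a ball is *$\lambda$-next to* a finite non-empty set $C\subset K$ if it is an intersection $\bigcap_{c\in C}B_c$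 with each $B_c$ a ball $\lambda$-next to $c$. A finite non-empty set $C$ *$\lambda$-prepares* $X\subset K$ if whether $x\in K$ lies in $X$ depends only on $(\mathrm{rv}_\lambda(x-c))_{c\in C}$. Let $\mathcal L$ be a language expanding $\{+,\cdot,\mathcal O_K\}$. A complete $\mathcal L$-theory of valued fields of equi-characteristic $0$ is *$1$-h-minimal* if for every model $K$, every $\lambda\le1$ in $\Gamma_K^\times$, every $A\subset K$ and every $A'\subset\mathrm{RV}_\lambda$ with $\#A'\le 1$, every $(A\cup\mathrm{RV}\cup A')$-definable set $X\subset K$ is $\lambda$-prepared by some finite non-empty $A$-definable set $C\subset K$. (Elements $\xi$ of $\mathrm{RV}$ and $\mathrm{RV}_\lambda$ are used as parameters by adding to $\mathcal L$ unary predicates for their preimages in $K$.) The derivative $f'(x)$ of $f\colon K\to K$ at $x$ is the element $a\in K$ such that for every $\varepsilon\in\Gamma_K^\times$ there is $\delta\in\Gamma_K^\times$ with $\left|\frac{f(x)-f(y)}{x-y}-a\right|<\varepsilon$ for all $y\ne x$ with $|x-y|<\delta$, if such an $a$ exists. **Theorem (Jacobian Property).** Let $K$ be a valued field of equi-characteristic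 $0$, considered as a structure in a language $\mathcal L\supset\{+,\cdot,\mathcal O_K\}$, such that $\mathrm{Th}_{\mathcal L}(K)$ is $1$-h-minimal, and let $f\colon K\to K$ be a $\emptyset$-definable function. Then there exists a finite non-empty $\emptyset$-definable set $C\subset K$ such that for every $\lambda\le1$ in $\Gamma_K^\times$ and every ball $B$ $\lambda$-next to $C$: 1. the derivative $f'$ exists on $B$ and $\mathrm{rv}_\lambda\circ f'$ is constant on $B$; 2. for all $x_0\ne x$ in $B$, $\mathrm{rv}_\lambda\!\left(\frac{f(x)-f(x_0)}{x-x_0}\right)$ is equal to the constant value of $\mathrm{rv}_\lambda\circ f'$ on $B$; 3. for every open ball $B'\subset B$, the image $f(B')$ is either a point or an open ball. -/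

import Mathlib

open scoped FirstOrder

universe u v w

noncomputable section

namespace HMin

/-! ### The language of valued fields, and its expansions -/

/-- Function symbols of the language `{+, ·, 𝒪}` of valued fields. -/
inductive ValFunc : ℕ → Type
  | add : ValFunc 2
  | mul : ValFunc 2

/-- Relation symbols of the language `{+, ·, 𝒪}` of valued fields. -/
inductive ValRel : ℕ → Type
  | int : ValRel 1

/-- The language `{+, ·, 𝒪}` of valued fields. -/
def langVal : FirstOrder.Language.{0, 0} := ⟨ValFunc, ValRel⟩

/-- The `L`-structure `K`, where `φ` exhibits `L` as an expansion of the language of valued fields,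
is a non-trivially valued field of equi-characteristic `0`, with the field operations and the
valuation ring `O` interpreting the symbols `+`, `·`, `𝒪`. -/
structure IsValuedField {L : FirstOrder.Language.{u, v}} (φ : langVal →ᴸ L) {K : Type w} [Field K]
    [L.Structure K] (O : ValuationSubring K) : Prop where
  funMap_add : ∀ x : Fin 2 → K,
    FirstOrder.Language.Structure.funMap (φ.onFunction ValFunc.add) x = x 0 + x 1
  funMap_mul : ∀ x : Fin 2 → K,
    FirstOrder.Language.Structure.funMap (φ.onFunction ValFunc.mul) x = x 0 * x 1
  relMap_int : ∀ x : Fin 1 → K,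
    FirstOrder.Language.Structure.RelMap (φ.onRelation ValRel.int) x ↔ x 0 ∈ O
  ne_top : O ≠ ⊤
  charZero_residueField : CharZero (IsLocalRing.ResidueField O)

/-! ### Leading term structures, for an arbitrary (Krull-)valued field -/

section ValuedField

variable {K : Type w} [Field K] (O : ValuationSubring K)

/-- The elements `l ≤ 1` of the (multiplicative) value group of `K`. -/
abbrev Level : Type w := {l : (O.ValueGroup)ˣ // l ≤ 1}

variable {O}

theorem Level.val_le_one (l : Level O) : ((l : (O.ValueGroup)ˣ) : O.ValueGroup) ≤ 1 := by
  exact_mod_cast l.2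

theorem valuation_eq_one_of_sub_one_lt (l : Level O) {x : K}
    (hx : O.valuation (x - 1) < ((l : (O.ValueGroup)ˣ) : O.ValueGroup)) :
    O.valuation x = 1 := by
  have h1 : O.valuation (x - 1) < O.valuation 1 := by
    rw [map_one]; exact lt_of_lt_of_le hx l.val_le_one
  have h := Valuation.map_add_eq_of_lt_left O.valuation h1
  simpa using h

/-- The multiplicative group `1 + I`, where `I = {x | |x| < l}`. -/
def onePlus (l : Level O) : Subgroup Kˣ where
  carrier := {a | O.valuation ((a : K) - 1) < ((l : (O.ValueGroup)ˣ) : O.ValueGroup)}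
  one_mem' := by simp
  mul_mem' := by
    intro a b ha hb
    have ha' := valuation_eq_one_of_sub_one_lt l ha
    simp only [Set.mem_ofPred_eq] at ha hb ⊢
    have e : ((a * b : Kˣ) : K) - 1 = (a : K) * ((b : K) - 1) + ((a : K) - 1) := by
      push_cast; ring
    rw [e]
    refine Valuation.map_add_lt _ ?_ ha
    rw [map_mul, ha', one_mul]
    exact hb
  inv_mem' := by
    intro a ha
    have ha' := valuation_eq_one_of_sub_one_lt l ha
    simp only [Set.mem_ofPred_eq] at ha ⊢
    have e : ((a⁻¹ : Kˣ) : K) - 1 = -((a : K)⁻¹ * ((a : K) - 1)) := by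
      have := a.ne_zero
      push_cast
      field_simp
      ring
    rw [e, Valuation.map_neg, map_mul, map_inv₀, ha', inv_one, one_mul]
    exact ha

/-- `RV_l = Kˣ / (1 + I) ∪ {0}`, where `I = {x | |x| < l}`. -/
abbrev RV (l : Level O) : Type w := WithZero (Kˣ ⧸ onePlus l)

open Classical in
/-- The leading term map `rv_l : K → RV_l`. -/
def rv (l : Level O) (x : K) : RV l :=
  if h : x = 0 then 0 else (((Units.mk0 x h : Kˣ) : Kˣ ⧸ onePlus l) : RV l)

/-! ### Prepared sets, balls, derivatives -/

/-- `C` `l`-prepares `X` (for `C` finite and non-empty): whether `x` lies in `X` depends only on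
the tuple `(rv_l (x - c))_{c ∈ C}`. -/
def Prepares (l : Level O) (C X : Set K) : Prop :=
  C.Finite ∧ C.Nonempty ∧
    ∀ x x' : K, (∀ c ∈ C, rv l (x - c) = rv l (x' - c)) → (x ∈ X ↔ x' ∈ X)

variable (O) in
/-- Balls of `K`. -/
def IsBall (B : Set K) : Prop :=
  B.Infinite ∧ B ≠ Set.univ ∧
    ∀ x ∈ B, ∀ x' ∈ B, ∀ y : K, O.valuation (x - y) ≤ O.valuation (x - x') → y ∈ B

variable (O) in
/-- Open balls of `K`. -/
def IsOpenBall (B : Set K) : Prop :=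
  ∃ (a : K) (g : (O.ValueGroup)ˣ), B = {x | O.valuation (x - a) < (g : O.ValueGroup)}

/-- The ball `B` is `l`-next to the element `c`. -/
def IsNextToPoint (l : Level O) (B : Set K) (c : K) : Prop :=
  IsBall O B ∧ ∃ ξ : RV l, ξ ≠ 0 ∧ B = {x | rv l (x - c) = ξ}

/-- The ball `B` is `l`-next to the (finite, non-empty) set `C`. -/
def IsNextTo (l : Level O) (B C : Set K) : Prop :=
  IsBall O B ∧ ∃ D : K → Set K, (∀ c ∈ C, IsNextToPoint l (D c) c) ∧ B = ⋂ c ∈ C, D c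

variable (O) in
/-- `a` is the (classical) derivative of `f` at `x`. -/
def HasDeriv (f : K → K) (x a : K) : Prop :=
  ∀ ε : (O.ValueGroup)ˣ, ∃ δ : (O.ValueGroup)ˣ, ∀ y : K,
    O.valuation (x - y) < (δ : O.ValueGroup) → x ≠ y →
      O.valuation ((f x - f y) / (x - y) - a) < (ε : O.ValueGroup)

end ValuedField

/-! ### Definability with imaginary parameters -/

/-- Unary relation symbols indexed by `ι`. -/
inductive UnaryRel (ι : Type w) : ℕ → Type w
  | mk (i : ι) : UnaryRel ι 1

/-- The language with one unary predicate for each element of `ι`, and nothing else. -/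
def unaryLang (ι : Type w) : FirstOrder.Language.{0, w} := ⟨fun _ => Empty, UnaryRel ι⟩

/-- The interpretation of the predicate with index `i` as the set `P i`. -/
@[reducible] def unaryStructure {ι M : Type w} (P : ι → Set M) : (unaryLang ι).Structure M where
  funMap := fun f _ => nomatch f
  RelMap := fun r x =>
    match r, x with
    | UnaryRel.mk i, x => x 0 ∈ P i

/-- `X ⊆ M` is definable in the expansion of `L` by constants for the elements of `A` and by
predicates for the elements of `P`, which are subsets of `M`. -/
def DefinableOver (L : FirstOrder.Language.{u, v}) {M : Type w} [L.Structure M] (A : Set M)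
    (P : Set (Set M)) (X : Set M) : Prop :=
  letI : (unaryLang P).Structure M := unaryStructure (fun p : P => (p : Set M))
  A.Definable₁ (L.sum (unaryLang P)) X

/-! ### Hensel minimality -/

/-- `X` is `(A ∪ RV ∪ A')`-definable, where `A ⊆ K` and `A' ⊆ RV_l`: elements of `RV` and of `A'`
are used as parameters through their preimages in `K`. -/
def RVDefinable (L : FirstOrder.Language.{u, v}) {K : Type w} [Field K] [L.Structure K]
    {O : ValuationSubring K} (l : Level O) (A : Set K) (A' : Set (RV l)) (X : Set K) : Prop :=
  DefinableOver L A
    ({F | ∃ ξ : RV (⟨1, le_rfl⟩ : Level O), F = rv ⟨1, le_rfl⟩ ⁻¹' {ξ}} ∪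
      {F | ∃ ξ ∈ A', F = rv l ⁻¹' {ξ}}) X

/-- The theory `T` is a complete theory of (non-trivially) valued fields of equi-characteristic `0`
and it is `ℓ`-h-minimal, for `ℓ ∈ ℕ ∪ {ω}` (`⊤` stands for `ω`). Field structure and valuation ring
on a model of `T` are determined by its `L`-structure. -/
structure IsHMinimal {L : FirstOrder.Language.{u, v}} (φ : langVal →ᴸ L) (ℓ : ℕ∞) (T : L.Theory) : Prop where
  isComplete : T.IsComplete
  isValuedField : ∀ (K : Type (max u v w)) [L.Structure K] [Nonempty K], K ⊨ T →
    ∃ (_ : Field K) (O : ValuationSubring K), IsValuedField φ O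
  exists_prepares : ∀ (K : Type (max u v w)) [Field K] [L.Structure K] (O : ValuationSubring K),
    IsValuedField φ O → K ⊨ T →
    ∀ (l : Level O) (A : Set K) (A' : Set (RV l)), A'.encard ≤ ℓ →
      ∀ X : Set K, RVDefinable L l A A' X →
        ∃ C : Set K, A.Definable₁ L C ∧ Prepares l C X

end HMin

end

/-! Levels are represented by field elements: `Close O l` is equality of leading terms at level
`|l|`, and every ball `|l|`-next to `C` is a class of `SameClass O l C` disjoint from `C`. The
engine is `exists_uniform_preparation`: 1-h-minimality prepares one set in one model, and
compactness over all models yields one definable finite set that works for all leading term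
parameters and all levels simultaneously.

Slopes. Let `p ≠ q` lie in one class of level `|l|`, with `e = q - p` and secant slope `z`. Having a
secant of leading term `rv e` and slope close to `z` is a prepared property, so it holds throughout
the class, and such secants can be chained. After `n` steps they reach a point `x` near `p + n e` at
which `h = F - z·id - (F p - z p)` vanishes or is smaller than `|l z e|`. In residue characteristic
`0` the open balls of radius `|e|` around the points `p + n e` are disjoint, so for some `n` the
ball avoids the finite set preparing `h`. On that ball, preparation at a suitably small level keeps
the slopes of `h` below `|l z|` (`secantBall_of_chain`), so all secants of `F` there have slope
close to `z`. This is again a prepared property, so it spreads to the whole class, and comparing two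
secants on a common small ball gives `ControlsSlopes.close_slope`.

Derivative. The approximate slopes at a point form a nested family of nonempty leading term classes.
In general such a family may have empty intersection, but here one finite set prepares the entire
family, and this forces a common point (`ControlsSlopes.exists_approxSlope`).

Images. By the slope estimate, an open ball maps into an open ball of the expected radius. A missed
value would be a prepared defect, hence could be moved along `p + k e` until its target ball avoids
the finite set preparing the images, where nothing can be missed (`exists_preimage`). A ball as
large as its distance to `C` is treated separately, by also preparing the fibres of `F`. -/

noncomputable section

namespace HMin

open FirstOrder FirstOrder.Language

/-! ### Leading terms, classes modulo a finite set, and residue characteristic zero -/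

section Valued

variable {K : Type w} [Field K] (O : ValuationSubring K)

/-- `x` and `y` have the same leading term at level `|l|`. -/
def Close (l x y : K) : Prop := x = y ∨ O.valuation (x - y) < O.valuation (l * x)

/-- `x` and `y` are equivalent for the relation of `|l|`-preparation by `C`. -/
def SameClass (l : K) (C : Set K) (x y : K) : Prop := ∀ c ∈ C, Close O l (x - c) (y - c)

variable {O} {l x y z : K}

theorem Close.refl (l x : K) : Close O l x x := Or.inl rfl

theorem Close.val_eq (hl : O.valuation l ≤ 1) (h : Close O l x y) :
    O.valuation x = O.valuation y := by
  rcases h with rfl | h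
  · rfl
  · have h1 : O.valuation (y - x) < O.valuation x := by
      rw [Valuation.map_sub_swap]
      refine h.trans_le ?_
      rw [map_mul]
      exact mul_le_of_le_one_left' hl
    have := Valuation.map_add_eq_of_lt_left O.valuation h1
    simpa using this.symm

theorem Close.symm (hl : O.valuation l ≤ 1) (h : Close O l x y) : Close O l y x := by
  have he := h.val_eq hl
  rcases h with rfl | h
  · exact Or.inl rfl
  · right
    rwa [Valuation.map_sub_swap, map_mul, ← he, ← map_mul]

theorem Close.trans (hl : O.valuation l ≤ 1) (h : Close O l x y) (h' : Close O l y z) :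
    Close O l x z := by
  have he := h.val_eq hl
  rcases h with rfl | h
  · exact h'
  rcases h' with rfl | h'
  · exact Or.inr h
  right
  rw [← sub_add_sub_cancel x y z]
  refine Valuation.map_add_lt _ h ?_
  rwa [map_mul, he, ← map_mul]

theorem Close.mul_right (h : Close O l x y) (w : K) : Close O l (x * w) (y * w) := by
  rcases h with rfl | h
  · exact Or.inl rfl
  by_cases hw : w = 0
  · subst hw; left; simp
  right
  rw [← sub_mul, ← mul_assoc, map_mul, map_mul _ _ w]
  exact mul_lt_mul_of_pos_right h (by simpa [zero_lt_iff] using hw)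

theorem Close.cancel_right {w : K} (hw : w ≠ 0) (h : Close O l (x * w) (y * w)) :
    Close O l x y := by
  have := h.mul_right w⁻¹
  simpa [mul_assoc, hw] using this

theorem Close.mono {l' : K} (hl : O.valuation l ≤ O.valuation l') (h : Close O l x y) :
    Close O l' x y := by
  rcases h with rfl | h
  · exact Or.inl rfl
  · right
    refine h.trans_le ?_
    rw [map_mul, map_mul]
    exact mul_le_mul_left hl _

theorem Close.one (hl : O.valuation l ≤ 1) (h : Close O l x y) : Close O 1 x y :=
  h.mono (by simpa using hl)

theorem close_iff_of_val_eq {l' : K} (hl : O.valuation l = O.valuation l') :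
    Close O l x y ↔ Close O l' x y :=
  ⟨fun h => h.mono hl.le, fun h => h.mono hl.ge⟩

theorem Close.zero_iff : Close O l 0 x ↔ x = 0 := by
  simp [Close, eq_comm]

theorem Close.zero_iff' (hl : O.valuation l ≤ 1) : Close O l x 0 ↔ x = 0 :=
  ⟨fun h => Close.zero_iff.1 (h.symm hl), fun h => h ▸ Or.inl rfl⟩

theorem Close.lt_of_ne (h : Close O l x y) (hn : x ≠ y) :
    O.valuation (x - y) < O.valuation (l * x) := h.resolve_left hn

theorem rv_eq_iff (m : Level O) {l : K}
    (hl : O.valuation l = ((m : (O.ValueGroup)ˣ) : O.ValueGroup)) (x y : K) :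
    rv m x = rv m y ↔ Close O l x y := by
  unfold rv
  have hl1 : O.valuation l ≤ 1 := hl ▸ m.val_le_one
  by_cases hx : x = 0
  · subst hx
    by_cases hy : y = 0
    · subst hy; simp [Close]
    · simp [hy, Close.zero_iff]
  · by_cases hy : y = 0
    · subst hy; simp [hx, Close.zero_iff' hl1]
    · simp only [hx, hy, dif_neg, not_false_eq_true, WithZero.coe_inj]
      rw [QuotientGroup.eq]
      change O.valuation _ < _ ↔ _
      rw [← hl]
      have e : (((Units.mk0 x hx)⁻¹ * Units.mk0 y hy : Kˣ) : K) - 1 = (y - x) * x⁻¹ := by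
        push_cast
        simp only [Units.val_mk0]
        field_simp
      rw [e, map_mul, map_inv₀, ← div_eq_mul_inv, div_lt_iff₀ (by simpa [zero_lt_iff] using hx),
        ← map_mul, Valuation.map_sub_swap]
      refine ⟨Or.inr, fun h => ?_⟩
      rcases h with rfl | h
      · rw [sub_self, map_zero, zero_lt_iff, map_mul, hl]
        simp [hx]
      · exact h

theorem exists_level (hl0 : l ≠ 0) (hl : O.valuation l ≤ 1) :
    ∃ m : Level O, O.valuation l = ((m : (O.ValueGroup)ˣ) : O.ValueGroup) :=
  ⟨⟨Units.mk0 (O.valuation l) (by simpa using hl0), by rw [← Units.val_le_val]; simpa using hl⟩, rfl⟩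

theorem exists_val_eq (g : (O.ValueGroup)ˣ) :
    ∃ l : K, l ≠ 0 ∧ O.valuation l = (g : O.ValueGroup) := by
  obtain ⟨l, hl⟩ := O.valuation_surjective g
  refine ⟨l, ?_, hl⟩
  rintro rfl
  simp only [map_zero] at hl
  exact g.ne_zero hl.symm

theorem exists_val_lt (hO : O ≠ ⊤) {w : K} (hw : w ≠ 0) :
    ∃ e : K, e ≠ 0 ∧ O.valuation e < O.valuation w := by
  obtain ⟨x, hx⟩ : ∃ x, x ∉ O := by
    by_contra! h
    exact hO (top_unique fun x _ => h x)
  have hx0 : x ≠ 0 := fun h => hx (h ▸ O.zero_mem)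
  refine ⟨w / x, div_ne_zero hw hx0, ?_⟩
  have h1 : 1 < O.valuation x := by
    rw [← not_le, O.valuation_le_one_iff]; exact hx
  rw [map_div₀, div_lt_iff₀ (zero_lt_one.trans h1)]
  exact lt_mul_of_one_lt_right (by simpa [zero_lt_iff] using hw) h1

theorem val_intCast [CharZero (IsLocalRing.ResidueField O)] {k : ℤ} (hk : k ≠ 0) :
    O.valuation (k : K) = 1 := by
  have h1 := (O.valuation_eq_one_iff (k : O)).1 ?_
  · simpa using h1
  · rw [← IsLocalRing.residue_ne_zero_iff_isUnit, map_intCast]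
    exact_mod_cast hk

theorem val_natCast [CharZero (IsLocalRing.ResidueField O)] {k : ℕ} (hk : k ≠ 0) :
    O.valuation (k : K) = 1 := by
  have := val_intCast (O := O) (k := k) (by exact_mod_cast hk)
  simpa using this

/-- Nonzero integers have valuation `1`, so the open balls of radius `|e|` around the points `p + n
e` are pairwise disjoint, and a finite set meets only finitely many of them. -/
theorem exists_nat_avoid [CharZero (IsLocalRing.ResidueField O)] {C : Set K} (hC : C.Finite)
    (p e : K) :
    ∃ n : ℕ, n ≠ 0 ∧ ∀ c ∈ C, O.valuation e ≤ O.valuation (c - p - n * e) := by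
  by_contra! h
  choose g hg hlt using fun n : ℕ => h (n + 1) n.succ_ne_zero
  refine Set.infinite_of_injective_forall_mem (f := g) (fun m n hmn => ?_) hg hC
  by_contra hne
  have h1 := hlt m
  have h2 := hlt n
  rw [hmn] at h1
  have h3 := Valuation.map_sub_lt _ h2 h1
  have e1 : (g n - p - ((n + 1 : ℕ) : K) * e) - (g n - p - ((m + 1 : ℕ) : K) * e) =
      (((m : ℤ) - n : ℤ) : K) * e := by push_cast; ring
  rw [e1, map_mul, val_intCast (by omega), one_mul] at h3
  exact lt_irrefl _ h3

theorem SameClass.refl (l : K) (C : Set K) (x : K) : SameClass O l C x x :=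
  fun _ _ => Close.refl _ _

variable {C D : Set K}

theorem SameClass.symm (hl : O.valuation l ≤ 1) (h : SameClass O l C x y) :
    SameClass O l C y x := fun c hc => (h c hc).symm hl

theorem SameClass.trans (hl : O.valuation l ≤ 1) (h : SameClass O l C x y)
    (h' : SameClass O l C y z) : SameClass O l C x z := fun c hc => (h c hc).trans hl (h' c hc)

theorem SameClass.anti (hD : D ⊆ C) (h : SameClass O l C x y) : SameClass O l D x y :=
  fun c hc => h c (hD hc)

theorem SameClass.mono {l' : K} (hl : O.valuation l ≤ O.valuation l')
    (h : SameClass O l C x y) : SameClass O l' C x y := fun c hc => (h c hc).mono hl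

theorem sameClass_of_lt (h : ∀ c ∈ C, O.valuation (x - y) < O.valuation (l * (x - c))) :
    SameClass O l C x y := fun c hc => Or.inr (by simpa using h c hc)

theorem SameClass.lt (h : SameClass O l C x y) (hn : x ≠ y) {c : K} (hc : c ∈ C) :
    O.valuation (x - y) < O.valuation (l * (x - c)) := by
  simpa using (h c hc).lt_of_ne (by simpa using hn)

/-- Any displacement no longer than one realized inside a class stays in the class, because `|x -
c|` is constant there for each `c ∈ C`. -/
theorem SameClass.of_le {p q : K} (hl : O.valuation l ≤ 1) (hxy : SameClass O l C x y)
    (hxp : SameClass O l C x p) (hn : x ≠ y) (h : O.valuation (p - q) ≤ O.valuation (x - y)) :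
    SameClass O l C x q := by
  refine hxp.trans hl (sameClass_of_lt fun c hc => h.trans_lt ?_)
  have := hxy.lt hn hc
  rwa [map_mul, ← (hxp c hc).val_eq hl, ← map_mul]

theorem SameClass.ne_of_notMem (hl : O.valuation l ≤ 1) (hx : x ∉ C) (h : SameClass O l C x y) :
    y ∉ C := by
  intro hy
  have := h y hy
  rw [sub_self, Close.zero_iff' hl, sub_eq_zero] at this
  exact hx (this ▸ hy)

theorem exists_nearest (hC : C.Finite) (hne : C.Nonempty) (x : K) :
    ∃ c ∈ C, ∀ c' ∈ C, O.valuation (x - c) ≤ O.valuation (x - c') :=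
  Set.exists_min_image C (fun c => O.valuation (x - c)) hC hne

end Valued

/-- A model of `T`, with its structure of a valued field. -/
structure Mod {L : FirstOrder.Language.{u, v}} (φ : langVal →ᴸ L) (T : L.Theory) where
  /-- the underlying set -/
  carrier : Type (max u v w)
  [field : Field carrier]
  [str : L.Structure carrier]
  /-- the valuation ring -/
  O : ValuationSubring carrier
  isValuedField : IsValuedField φ O
  models : carrier ⊨ T

attribute [instance] Mod.field Mod.str

instance {L : FirstOrder.Language.{u, v}} {φ : langVal →ᴸ L} {T : L.Theory} :
    CoeSort (Mod.{u, v, w} φ T) (Type (max u v w)) := ⟨Mod.carrier⟩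

/-! ### Relations defined by one formula in all models -/

section UDef

variable {L : FirstOrder.Language.{u, v}} {φ : langVal →ᴸ L} {T : L.Theory} {n : ℕ}

/-- `R` is defined by one and the same `L`-formula in all models of `T`. -/
def UDef (R : ∀ M : Mod.{u, v, w} φ T, (Fin n → M) → Prop) : Prop :=
  ∃ ψ : L.Formula (Fin n), ∀ (M : Mod.{u, v, w} φ T) (x : Fin n → M), ψ.Realize x ↔ R M x

/-- `t` is a function whose graph is defined by the same `L`-formula in all models of `T`. -/
def UFun (t : ∀ M : Mod.{u, v, w} φ T, (Fin n → M) → M) : Prop :=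
  UDef fun (M : Mod.{u, v, w} φ T) (x : Fin (n + 1) → M) => t M (fun i => x i.succ) = x 0

variable {R S : ∀ M : Mod.{u, v, w} φ T, (Fin n → M) → Prop}

theorem UDef.congr (hR : UDef R) (h : ∀ M x, R M x ↔ S M x) : UDef S := by
  obtain ⟨ψ, hψ⟩ := hR
  exact ⟨ψ, fun M x => (hψ M x).trans (h M x)⟩

theorem UDef.not (hR : UDef R) : UDef fun (M : Mod.{u, v, w} φ T) x => ¬ R M x := by
  obtain ⟨ψ, hψ⟩ := hR
  exact ⟨ψ.not, fun M x => by rw [Formula.realize_not, hψ]⟩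

theorem UDef.and (hR : UDef R) (hS : UDef S) :
    UDef fun (M : Mod.{u, v, w} φ T) x => R M x ∧ S M x := by
  obtain ⟨ψ, hψ⟩ := hR
  obtain ⟨χ, hχ⟩ := hS
  exact ⟨ψ ⊓ χ, fun M x => by rw [Formula.realize_inf, hψ, hχ]⟩

theorem UDef.or (hR : UDef R) (hS : UDef S) :
    UDef fun (M : Mod.{u, v, w} φ T) x => R M x ∨ S M x :=
  (hR.not.and hS.not).not.congr fun M x => by tauto

theorem UDef.imp (hR : UDef R) (hS : UDef S) :
    UDef fun (M : Mod.{u, v, w} φ T) x => R M x → S M x :=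
  (hR.and hS.not).not.congr fun M x => by tauto

theorem UDef.iff (hR : UDef R) (hS : UDef S) :
    UDef fun (M : Mod.{u, v, w} φ T) x => (R M x ↔ S M x) :=
  ((hR.imp hS).and (hS.imp hR)).congr fun M x => by tauto

theorem UDef.relabel {m : ℕ} (hR : UDef R) (g : Fin n → Fin m) :
    UDef fun (M : Mod.{u, v, w} φ T) (x : Fin m → M) => R M (fun i => x (g i)) := by
  obtain ⟨ψ, hψ⟩ := hR
  exact ⟨ψ.relabel g, fun M x => by rw [Formula.realize_relabel, hψ]; rfl⟩

theorem UDef.exists_tuple {k : ℕ} {R : ∀ M : Mod.{u, v, w} φ T, (Fin n → M) → (Fin k → M) → Prop}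
    (hR : UDef fun (M : Mod.{u, v, w} φ T) (x : Fin (n + k) → M) =>
      R M (fun i => x (i.castAdd k)) (fun i => x (i.natAdd n))) :
    UDef fun (M : Mod.{u, v, w} φ T) x => ∃ y, R M x y := by
  obtain ⟨ψ, hψ⟩ := hR
  refine ⟨(ψ.relabel (finSumFinEquiv.symm : Fin (n + k) → Fin n ⊕ Fin k)).iExs (Fin k),
    fun M x => ?_⟩
  rw [Formula.realize_iExs]
  refine exists_congr fun y => ?_
  rw [Formula.realize_relabel, hψ]
  simp

/-- The bound variable takes index `0` and the others shift up. Hence under nested quantifiers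
`UFun.var` counts from the innermost one. -/
theorem UDef.ex {R : ∀ M : Mod.{u, v, w} φ T, (Fin n → M) → M → Prop}
    (hR : UDef fun (M : Mod.{u, v, w} φ T) (x : Fin (n + 1) → M) =>
      R M (fun i => x i.succ) (x 0)) :
    UDef fun (M : Mod.{u, v, w} φ T) x => ∃ y, R M x y := by
  have h1 : UDef fun (M : Mod.{u, v, w} φ T) (x : Fin (n + 1) → M) =>
      R M (fun i => x (i.castAdd 1)) (x (Fin.natAdd n 0)) := by
    refine (hR.relabel (Fin.cons (Fin.natAdd n 0) (Fin.castAdd 1))).congr fun M x => ?_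
    simp
  refine (UDef.exists_tuple (R := fun M x y => R M x (y 0)) h1).congr fun M x => ?_
  exact ⟨fun ⟨y, hy⟩ => ⟨y 0, hy⟩, fun ⟨y, hy⟩ => ⟨fun _ => y, hy⟩⟩

theorem UDef.all {R : ∀ M : Mod.{u, v, w} φ T, (Fin n → M) → M → Prop}
    (hR : UDef fun (M : Mod.{u, v, w} φ T) (x : Fin (n + 1) → M) =>
      R M (fun i => x i.succ) (x 0)) :
    UDef fun (M : Mod.{u, v, w} φ T) x => ∀ y, R M x y :=
  (UDef.ex (R := fun M x y => ¬ R M x y) hR.not).not.congr fun M x => by simp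

theorem UDef.finset_exists {J : Type*} (s : Finset J)
    {R : J → ∀ M : Mod.{u, v, w} φ T, (Fin n → M) → Prop} (hR : ∀ j, UDef (R j)) :
    UDef fun (M : Mod.{u, v, w} φ T) x => ∃ j ∈ s, R j M x := by
  choose ψ hψ using hR
  refine ⟨Formula.iSup fun j : s => ψ j, fun M x => ?_⟩
  rw [Formula.realize_iSup]
  simp [hψ]

theorem UDef.finite_forall {J : Type*} [Finite J]
    {R : J → ∀ M : Mod.{u, v, w} φ T, (Fin n → M) → Prop} (hR : ∀ j, UDef (R j)) :
    UDef fun (M : Mod.{u, v, w} φ T) x => ∀ j, R j M x := by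
  choose ψ hψ using hR
  refine ⟨Formula.iInf ψ, fun M x => ?_⟩
  rw [Formula.realize_iInf]
  simp [hψ]

theorem UDef.eq_var (i j : Fin n) : UDef fun (_ : Mod.{u, v, w} φ T) x => x i = x j :=
  ⟨Term.equal (Term.var i) (Term.var j), fun M x => by simp [Formula.realize_equal]⟩

theorem UFun.var (i : Fin n) : UFun fun (_ : Mod.{u, v, w} φ T) x => x i :=
  UDef.eq_var i.succ 0

theorem UDef.subst {k : ℕ} {R : ∀ M : Mod.{u, v, w} φ T, (Fin k → M) → Prop} (hR : UDef R)
    {t : Fin k → ∀ M : Mod.{u, v, w} φ T, (Fin n → M) → M} (ht : ∀ i, UFun (t i)) :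
    UDef fun (M : Mod.{u, v, w} φ T) x => R M (fun i => t i M x) := by
  have h : UDef fun (M : Mod.{u, v, w} φ T) (x : Fin n → M) =>
      ∃ y : Fin k → M, (∀ i, t i M x = y i) ∧ R M y := by
    refine UDef.exists_tuple (UDef.and (UDef.finite_forall fun i => ?_) (hR.relabel _))
    have := (ht i).relabel (Fin.cons (Fin.natAdd n i) (Fin.castAdd k))
    simpa using this
  refine h.congr fun M x => ?_
  constructor
  · rintro ⟨y, hy, h⟩
    rwa [funext hy]
  · exact fun h => ⟨_, fun _ => rfl, h⟩

theorem UDef.comp₁ {R : ∀ M : Mod.{u, v, w} φ T, M → Prop}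
    (hR : UDef fun (M : Mod.{u, v, w} φ T) (x : Fin 1 → M) => R M (x 0))
    {t : ∀ M : Mod.{u, v, w} φ T, (Fin n → M) → M} (ht : UFun t) :
    UDef fun (M : Mod.{u, v, w} φ T) x => R M (t M x) :=
  hR.subst (t := fun _ => t) fun _ => ht

theorem UDef.comp₂ {R : ∀ M : Mod.{u, v, w} φ T, M → M → Prop}
    (hR : UDef fun (M : Mod.{u, v, w} φ T) (x : Fin 2 → M) => R M (x 0) (x 1))
    {t t' : ∀ M : Mod.{u, v, w} φ T, (Fin n → M) → M} (ht : UFun t) (ht' : UFun t') :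
    UDef fun (M : Mod.{u, v, w} φ T) x => R M (t M x) (t' M x) :=
  hR.subst (t := ![t, t']) (by simp [Fin.forall_fin_two, ht, ht'])

theorem UDef.comp₃ {R : ∀ M : Mod.{u, v, w} φ T, M → M → M → Prop}
    (hR : UDef fun (M : Mod.{u, v, w} φ T) (x : Fin 3 → M) => R M (x 0) (x 1) (x 2))
    {t t' t'' : ∀ M : Mod.{u, v, w} φ T, (Fin n → M) → M} (ht : UFun t) (ht' : UFun t')
    (ht'' : UFun t'') :
    UDef fun (M : Mod.{u, v, w} φ T) x => R M (t M x) (t' M x) (t'' M x) :=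
  hR.subst (t := ![t, t', t'']) (by
    intro i; fin_cases i
    · exact ht
    · exact ht'
    · exact ht'')

theorem UFun.succ {t : ∀ M : Mod.{u, v, w} φ T, (Fin n → M) → M} (ht : UFun t) :
    UFun fun (M : Mod.{u, v, w} φ T) (x : Fin (n + 1) → M) => t M fun i => x i.succ := by
  refine (UDef.relabel ht (Fin.cons 0 fun i => i.succ.succ)).congr fun M x => ?_
  simp

theorem UDef.eq {t t' : ∀ M : Mod.{u, v, w} φ T, (Fin n → M) → M} (ht : UFun t) (ht' : UFun t') :
    UDef fun (M : Mod.{u, v, w} φ T) x => t M x = t' M x :=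
  UDef.comp₂ (R := fun _ a b => a = b) (UDef.eq_var 0 1) ht ht'

theorem UFun.comp₁ {F : ∀ M : Mod.{u, v, w} φ T, M → M}
    (hF : UFun fun (M : Mod.{u, v, w} φ T) (x : Fin 1 → M) => F M (x 0))
    {t : ∀ M : Mod.{u, v, w} φ T, (Fin n → M) → M} (ht : UFun t) :
    UFun fun (M : Mod.{u, v, w} φ T) x => F M (t M x) :=
  UDef.comp₂ (R := fun M a b => F M b = a) hF (UFun.var 0) ht.succ

theorem UFun.comp₂ {F : ∀ M : Mod.{u, v, w} φ T, M → M → M}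
    (hF : UFun fun (M : Mod.{u, v, w} φ T) (x : Fin 2 → M) => F M (x 0) (x 1))
    {t t' : ∀ M : Mod.{u, v, w} φ T, (Fin n → M) → M} (ht : UFun t) (ht' : UFun t') :
    UFun fun (M : Mod.{u, v, w} φ T) x => F M (t M x) (t' M x) :=
  UDef.comp₃ (R := fun M a b c => F M b c = a) hF (UFun.var 0) ht.succ ht'.succ

theorem udef_add_eq : UDef fun (M : Mod.{u, v, w} φ T) (x : Fin 3 → M) => x 0 + x 1 = x 2 :=
  ⟨Term.equal ((φ.onFunction ValFunc.add).apply₂ (Term.var 0) (Term.var 1)) (Term.var 2),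
    fun M x => by
      simp [Formula.realize_equal, Term.realize_functions_apply₂, M.isValuedField.funMap_add]⟩

theorem udef_mul_eq : UDef fun (M : Mod.{u, v, w} φ T) (x : Fin 3 → M) => x 0 * x 1 = x 2 :=
  ⟨Term.equal ((φ.onFunction ValFunc.mul).apply₂ (Term.var 0) (Term.var 1)) (Term.var 2),
    fun M x => by
      simp [Formula.realize_equal, Term.realize_functions_apply₂, M.isValuedField.funMap_mul]⟩

theorem udef_mem : UDef fun (M : Mod.{u, v, w} φ T) (x : Fin 1 → M) => x 0 ∈ M.O :=
  ⟨Relations.formula₁ (φ.onRelation ValRel.int) (Term.var 0), fun M x => by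
    rw [Formula.realize_rel₁, M.isValuedField.relMap_int]; simp⟩

variable {t t' : ∀ M : Mod.{u, v, w} φ T, (Fin n → M) → M}

theorem UFun.add (ht : UFun t) (ht' : UFun t') :
    UFun fun (M : Mod.{u, v, w} φ T) x => t M x + t' M x :=
  UFun.comp₂ (F := fun _ a b => a + b) (udef_add_eq.relabel ![1, 2, 0]) ht ht'

theorem UFun.mul (ht : UFun t) (ht' : UFun t') :
    UFun fun (M : Mod.{u, v, w} φ T) x => t M x * t' M x :=
  UFun.comp₂ (F := fun _ a b => a * b) (udef_mul_eq.relabel ![1, 2, 0]) ht ht'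

theorem UFun.sub (ht : UFun t) (ht' : UFun t') :
    UFun fun (M : Mod.{u, v, w} φ T) x => t M x - t' M x := by
  refine UFun.comp₂ (F := fun M a b => a - b) ?_ ht ht'
  refine (udef_add_eq.relabel ![0, 2, 1]).congr fun M x => ?_
  simp only [Matrix.cons_val]
  rw [sub_eq_iff_eq_add, eq_comm]
  rfl

theorem UFun.zero : UFun fun (M : Mod.{u, v, w} φ T) (_ : Fin n → M) => (0 : M) := by
  refine (UDef.eq (UFun.add (UFun.var 0) (UFun.var 0)) (UFun.var 0)).congr fun M x => ?_
  rw [add_eq_right, eq_comm]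

/-- The constants are not symbols of the basic language: `0` is the additive idempotent and `1` the
nonzero multiplicative one. -/
theorem UFun.one : UFun fun (M : Mod.{u, v, w} φ T) (_ : Fin n → M) => (1 : M) := by
  refine ((UDef.eq (UFun.mul (UFun.var 0) (UFun.var 0)) (UFun.var 0)).and
    (UDef.eq (UFun.var 0) UFun.zero).not).congr fun M x => ?_
  constructor
  · rintro ⟨h, h0⟩
    exact (mul_eq_left₀ h0).1 h |>.symm
  · intro h
    simp [← h]

theorem UDef.val_le (ht : UFun t) (ht' : UFun t') :
    UDef fun (M : Mod.{u, v, w} φ T) x => M.O.valuation (t M x) ≤ M.O.valuation (t' M x) := by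
  have h : UDef fun (M : Mod.{u, v, w} φ T) (x : Fin n → M) =>
      ∃ c, c ∈ M.O ∧ c * t' M x = t M x :=
    UDef.ex ((UDef.comp₁ (R := fun M a => a ∈ M.O) udef_mem (UFun.var 0)).and
      (UDef.eq (UFun.mul (UFun.var 0) ht'.succ) ht.succ))
  refine h.congr fun M x => ?_
  rw [ValuationSubring.valuation_le_iff]
  exact ⟨fun ⟨c, hc, h⟩ => ⟨⟨c, hc⟩, h⟩, fun ⟨c, h⟩ => ⟨c, c.2, h⟩⟩

theorem UDef.val_lt (ht : UFun t) (ht' : UFun t') :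
    UDef fun (M : Mod.{u, v, w} φ T) x => M.O.valuation (t M x) < M.O.valuation (t' M x) :=
  (UDef.val_le ht' ht).not.congr fun M x => by rw [not_le]

theorem UDef.close {s : ∀ M : Mod.{u, v, w} φ T, (Fin n → M) → M} (hs : UFun s) (ht : UFun t)
    (ht' : UFun t') :
    UDef fun (M : Mod.{u, v, w} φ T) x => Close M.O (s M x) (t M x) (t' M x) :=
  (UDef.eq ht ht').or (UDef.val_lt (ht.sub ht') (hs.mul ht))

theorem UDef.sameClass {s : ∀ M : Mod.{u, v, w} φ T, (Fin n → M) → M}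
    {C : ∀ M : Mod.{u, v, w} φ T, (Fin n → M) → Set M}
    (hC : UDef fun (M : Mod.{u, v, w} φ T) (x : Fin (n + 1) → M) => x 0 ∈ C M fun i => x i.succ)
    (hs : UFun s) (ht : UFun t) (ht' : UFun t') :
    UDef fun (M : Mod.{u, v, w} φ T) x => SameClass M.O (s M x) (C M x) (t M x) (t' M x) :=
  UDef.all (hC.imp (UDef.close hs.succ (ht.succ.sub (UFun.var 0)) (ht'.succ.sub (UFun.var 0))))

end UDef

/-! ### Compactness by ultraproducts, and transfer between models -/

section Compactness

variable {L : FirstOrder.Language.{u, v}} {φ : langVal →ᴸ L} {T : L.Theory} {n : ℕ}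

/-- Compactness for families of uniformly definable relations. -/
theorem UDef.compactness {l : ℕ∞} (hT : IsHMinimal.{u, v, w} φ l T) {J : Type (max u v w)}
    {S : ∀ M : Mod.{u, v, w} φ T, (Fin n → M) → Prop} (hS : UDef S)
    {P : J → ∀ M : Mod.{u, v, w} φ T, (Fin n → M) → Prop} (hP : ∀ j, UDef (P j))
    (h : ∀ M x, S M x → ∃ j, P j M x) :
    ∃ s : Finset J, ∀ M x, S M x → ∃ j ∈ s, P j M x := by
  classical
  by_contra! hc
  -- Each finite `s` has a counterexample. An ultrafilter containing all sets `{s | j ∈ s}` makes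
  -- the ultraproduct of these counterexamples fail every `P j`.
  choose M x hSx hPx using hc
  let U : Ultrafilter (Finset J) := Ultrafilter.of Filter.atTop
  have : ∀ s, Nonempty (M s) := fun s => ⟨0⟩
  have hmod : ((U : Filter (Finset J)).Product fun s => (M s : Type (max u v w))) ⊨ T := by
    rw [Theory.model_iff]
    intro σ hσ
    rw [Ultraproduct.sentence_realize]
    exact Filter.Eventually.of_forall fun s => (Theory.model_iff T).1 (M s).models σ hσ
  obtain ⟨F, O, hF⟩ := hT.isValuedField _ hmod
  let N : Mod.{u, v, w} φ T := ⟨_, O, hF, hmod⟩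
  have cast : ∀ ψ : L.Formula (Fin n), (ψ.Realize (M := N)
      fun i => ((fun s => x s i : ∀ s, M s) : (U : Filter (Finset J)).Product fun s => M s)) ↔
      ∀ᶠ s in (U : Filter (Finset J)), ψ.Realize (x s) := fun ψ =>
    Ultraproduct.realize_formula_cast ψ (fun i s => x s i)
  obtain ⟨ψ, hψ⟩ := hS
  obtain ⟨j, hj⟩ := h N _ ((hψ N _).1 ((cast ψ).2
    (Filter.Eventually.of_forall fun s => (hψ _ _).2 (hSx s))))
  obtain ⟨χ, hχ⟩ := hP j
  have h1 := (cast χ).1 ((hχ N _).2 hj)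
  have h2 : ∀ᶠ s in (U : Filter (Finset J)), ({j} : Finset J) ≤ s :=
    Ultrafilter.of_le Filter.atTop (Filter.eventually_ge_atTop ({j} : Finset J))
  obtain ⟨s, hs1, hs2⟩ := (h1.and h2).exists
  exact hPx s j (Finset.singleton_subset_iff.1 hs2) ((hχ _ _).1 hs1)

/-- The theory is complete, so a sentence true in one model is true in all. -/
theorem UDef.transfer {K : Type (max u v w)} [L.Structure K]
    {P : ∀ M : Mod.{u, v, w} φ (L.completeTheory K), (Fin 0 → M) → Prop} (hP : UDef P)
    {M₀ : Mod.{u, v, w} φ (L.completeTheory K)}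
    (h : P M₀ Fin.elim0) (M : Mod.{u, v, w} φ (L.completeTheory K)) : P M Fin.elim0 := by
  obtain ⟨ψ, hψ⟩ := hP
  let σ : L.Sentence := ψ.relabel Fin.elim0
  have hσ : ∀ M : Mod.{u, v, w} φ (L.completeTheory K), M ⊨ σ ↔ P M Fin.elim0 := fun M => by
    rw [← hψ, Sentence.Realize, Formula.realize_relabel, Subsingleton.elim (_ ∘ _) Fin.elim0]
  by_contra hM
  have h1 : ¬ K ⊨ σ := fun hK =>
    hM ((hσ M).1 ((Theory.model_iff _).1 M.models σ hK))
  have h2 : σ.not ∈ L.completeTheory K := by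
    rw [mem_completeTheory, Sentence.realize_not]; exact h1
  have h3 := (Theory.model_iff _).1 M₀.models _ h2
  rw [Sentence.realize_not] at h3
  exact h3 ((hσ M₀).2 h)

/-- The zero-definable set cut out by a uniformly definable predicate. -/
theorem UDef.definable₁ {P : ∀ M : Mod.{u, v, w} φ T, M → Prop}
    (hP : UDef fun (M : Mod.{u, v, w} φ T) (x : Fin 1 → M) => P M (x 0))
    (M : Mod.{u, v, w} φ T) : (∅ : Set M).Definable₁ L {x | P M x} := by
  obtain ⟨ψ, hψ⟩ := hP
  refine Set.empty_definable_iff.2 ⟨ψ, ?_⟩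
  ext x
  exact (hψ M x).symm

/-- A function that is `∅`-definable in one model extends to a uniformly definable function. -/
theorem exists_uFun {K : Type (max u v w)} [L.Structure K]
    (M₀ : Mod.{u, v, w} φ (L.completeTheory K)) (f : M₀ → M₀)
    (hf : (∅ : Set M₀).Definable₂ L {p : M₀ × M₀ | f p.1 = p.2}) :
    ∃ F : ∀ M : Mod.{u, v, w} φ (L.completeTheory K), M → M,
      (UFun fun (M : Mod.{u, v, w} φ (L.completeTheory K)) (x : Fin 1 → M) => F M (x 0)) ∧
        F M₀ = f := by
  classical
  obtain ⟨ψ, hψ⟩ := Set.empty_definable_iff.1 hf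
  let G : ∀ M : Mod.{u, v, w} φ (L.completeTheory K), M → M → Prop :=
    fun M x y => ψ.Realize ![x, y]
  have hG : UDef fun (M : Mod.{u, v, w} φ (L.completeTheory K)) (x : Fin 2 → M) =>
      G M (x 0) (x 1) := ⟨ψ, fun M x => by
        simp only [G]; congr! 1; ext i; fin_cases i <;> rfl⟩
  have hGf : ∀ x y, G M₀ x y ↔ f x = y := fun x y => by
    have := Set.ext_iff.1 hψ ![x, y]
    exact this.symm
  -- Being the graph of a function is a first-order property of the defining formula, so it passes
  -- from `M₀` to every model.
  have huniq : ∀ M : Mod.{u, v, w} φ (L.completeTheory K),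
      ∀ x, ∃ y, G M x y ∧ ∀ y', G M x y' → y' = y := by
    refine fun M => UDef.transfer (P := fun M _ => ∀ x, ∃ y, G M x y ∧ ∀ y', G M x y' → y' = y)
      ?_ (M₀ := M₀) (fun x => ⟨f x, (hGf _ _).2 rfl, fun y' hy' => ((hGf _ _).1 hy').symm⟩) M
    exact UDef.all (UDef.ex ((UDef.comp₂ hG (UFun.var 1) (UFun.var 0)).and
      (UDef.all ((UDef.comp₂ hG (UFun.var 2) (UFun.var 0)).imp
        (UDef.eq (UFun.var 0) (UFun.var 1))))))
  choose F hF hF' using huniq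
  refine ⟨F, (UDef.comp₂ hG (UFun.var 1) (UFun.var 0)).congr fun M x => ?_, ?_⟩
  · exact ⟨fun h => (hF' _ _ _ h).symm, fun h => h ▸ hF _ _⟩
  · funext x
    exact ((hGf _ _).1 (hF M₀ x)).symm

end Compactness

/-! ### Preparation uniform in parameters, levels and models -/

section Preparation

variable {L : FirstOrder.Language.{u, v}} {φ : langVal →ᴸ L} {T : L.Theory}

/-- `R` depends on its parameters `t`, `l`, `z` only through `rv t`, `rv l`, and `rv_l z`. -/
def LeadingTermInvariant (R : ∀ M : Mod.{u, v, w} φ T, M → M → M → M → M → M → Prop) : Prop :=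
  ∀ (M : Mod.{u, v, w} φ T) (a b t t' l l' z z' x : M), l ≠ 0 → M.O.valuation l ≤ 1 →
    Close M.O 1 t t' → Close M.O 1 l l' → Close M.O l z z' → R M x a b t l z → R M x a b t' l' z'

/-- Representatives of `rv t`, `rv l` and `rv_l z` can be quantified existentially: by invariance
their choice does not matter, so only the leading terms are needed as parameters. Just one of them,
`rv_l z`, lives at level `|l|`, as 1-h-minimality requires. -/
theorem rvDefinable_of_uDef {R : ∀ M : Mod.{u, v, w} φ T, M → M → M → M → M → M → Prop}
    (hR : UDef fun (M : Mod.{u, v, w} φ T) (x : Fin 6 → M) =>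
      R M (x 0) (x 1) (x 2) (x 3) (x 4) (x 5))
    (hinv : LeadingTermInvariant R) (M : Mod.{u, v, w} φ T) (a b t l z : M) (hl0 : l ≠ 0)
    (hl1 : M.O.valuation l ≤ 1) (m : Level M.O)
    (hm : M.O.valuation l = ((m : (M.O.ValueGroup)ˣ) : M.O.ValueGroup)) :
    RVDefinable L m {a, b} {rv m z} {x | R M x a b t l z} := by
  set e : Level M.O := ⟨1, le_rfl⟩ with he
  have hrv1 : ∀ x y : M, rv e x = rv e y ↔ Close M.O 1 x y := rv_eq_iff e (by simp [he])
  have hrvm : ∀ x y : M, rv m x = rv m y ↔ Close M.O l x y := rv_eq_iff m hm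
  unfold RVDefinable DefinableOver
  set P : Set (Set M) := {F | ∃ ξ : RV e, F = rv e ⁻¹' {ξ}} ∪ {F | ∃ ξ ∈ ({rv m z} : Set (RV m)),
    F = rv m ⁻¹' {ξ}} with hP
  let _ : (unaryLang P).Structure M := unaryStructure (fun p : P => (p : Set M))
  have hpred : ∀ (p : P) (i : Fin 4),
      (({a, b} : Set M)).Definable (L.sum (unaryLang P)) {y : Fin 4 → M | y i ∈ (p : Set M)} := by
    intro p i
    refine Set.Definable.mono (Set.empty_definable_iff.2
      ⟨Relations.formula₁ (Sum.inr (UnaryRel.mk p) : (L.sum (unaryLang P)).Relations 1)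
        (Term.var i), ?_⟩) (Set.empty_subset _)
    ext y
    simp only [Set.mem_ofPred_eq]
    rfl
  have hbase : (({a, b} : Set M)).Definable L
      {y : Fin 4 → M | R M (y 0) a b (y 1) (y 2) (y 3)} := by
    obtain ⟨ψ, hψ⟩ := hR
    refine Set.definable_iff_exists_formula_sum.2
      ⟨ψ.relabel ![Sum.inr 0, Sum.inl ⟨a, by simp⟩, Sum.inl ⟨b, by simp⟩, Sum.inr 1, Sum.inr 2,
        Sum.inr 3], ?_⟩
    ext y
    simp only [Set.mem_ofPred_eq, Formula.realize_relabel, hψ]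
    rfl
  have hbase' := hbase.map_expansion (LHom.sumInl : L →ᴸ L.sum (unaryLang P))
  have hall := ((hbase'.inter (hpred ⟨rv e ⁻¹' {rv e t}, Or.inl ⟨_, rfl⟩⟩ 1)).inter
    (hpred ⟨rv e ⁻¹' {rv e l}, Or.inl ⟨_, rfl⟩⟩ 2)).inter
    (hpred ⟨rv m ⁻¹' {rv m z}, Or.inr ⟨_, rfl, rfl⟩⟩ 3)
  have := hall.image_comp (fun _ : Fin 1 => (0 : Fin 4))
  unfold Set.Definable₁
  convert this using 1
  ext x
  simp only [Set.mem_ofPred_eq, Set.mem_image, Set.mem_inter_iff, Set.mem_preimage,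
    Set.mem_singleton_iff]
  constructor
  · intro hx
    refine ⟨![x 0, t, l, z], ⟨⟨⟨hx, rfl⟩, rfl⟩, rfl⟩, ?_⟩
    ext i
    rw [Subsingleton.elim i 0]; rfl
  · rintro ⟨y, ⟨⟨⟨hy, h1⟩, h2⟩, h3⟩, rfl⟩
    rw [hrv1] at h1 h2
    rw [hrvm] at h3
    have hv := h2.val_eq (by simp)
    refine hinv M a b _ _ _ _ _ _ _ ?_ (hv ▸ hl1) h1 h2 ((close_iff_of_val_eq hv).2 h3) hy
    rw [← M.O.valuation.ne_zero_iff, hv]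
    simpa using hl0

theorem exists_formula_prepares (hT : IsHMinimal.{u, v, w} φ 1 T)
    {R : ∀ M : Mod.{u, v, w} φ T, M → M → M → M → M → M → Prop}
    (hR : UDef fun (M : Mod.{u, v, w} φ T) (x : Fin 6 → M) =>
      R M (x 0) (x 1) (x 2) (x 3) (x 4) (x 5))
    (hinv : LeadingTermInvariant R) (M : Mod.{u, v, w} φ T) (a b t l z : M) (hl0 : l ≠ 0)
    (hl1 : M.O.valuation l ≤ 1) :
    ∃ ψ : L.Formula (Fin 3), {x : M | ψ.Realize ![x, a, b]}.Finite ∧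
      ∀ x x', SameClass M.O l {x : M | ψ.Realize ![x, a, b]} x x' →
        (R M x a b t l z ↔ R M x' a b t l z) := by
  obtain ⟨m, hm⟩ := exists_level hl0 hl1
  obtain ⟨C, hC, hfin, -, hprep⟩ := hT.exists_prepares M M.O M.isValuedField M.models m {a, b}
    {rv m z} (by simp) _ (rvDefinable_of_uDef hR hinv M a b t l z hl0 hl1 m hm)
  obtain ⟨χ, hχ⟩ := Set.definable_iff_exists_formula_sum.1 hC
  classical
  let g : ({a, b} : Set M) ⊕ Fin 1 → Fin 3 := Sum.elim (fun c => if (c : M) = a then 1 else 2)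
    fun _ => 0
  have hψ : {x : M | (χ.relabel g).Realize ![x, a, b]} = C := by
    ext x
    have := Set.ext_iff.1 hχ ![x]
    simp only [Set.mem_ofPred_eq, Formula.realize_relabel] at this ⊢
    have e : (![x, a, b] : Fin 3 → M) ∘ g = Sum.elim (fun c : ({a, b} : Set M) => (c : M)) ![x] := by
      funext c
      rcases c with ⟨c, hc⟩ | i
      · by_cases h : c = a
        · simp [g, h]
        · have : c = b := by simpa [h] using hc
          subst this
          simp [g, h]
      · rw [Subsingleton.elim i 0]; simp [g]
    rw [e, ← this]
    simp
  refine ⟨χ.relabel g, ?_, ?_⟩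
  · rw [hψ]; exact hfin
  · rw [hψ]
    intro x x' h
    exact hprep x x' fun c hc => (rv_eq_iff m hm _ _).2 (h c hc)

/-- Finiteness is not first-order, but a bound on the cardinality is. The compactness argument
therefore ranges over pairs of a formula and a bound. -/
theorem udef_finite_le {n : ℕ} {C : ∀ M : Mod.{u, v, w} φ T, (Fin n → M) → Set M}
    (hC : UDef fun (M : Mod.{u, v, w} φ T) (x : Fin (n + 1) → M) => x 0 ∈ C M fun i => x i.succ)
    (N : ℕ) :
    UDef fun (M : Mod.{u, v, w} φ T) x => ∃ y : Fin N → M, ∀ c, c ∈ C M x → ∃ i, c = y i := by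
  refine UDef.exists_tuple (UDef.all (UDef.imp ?_ ?_))
  · refine (hC.relabel (Fin.cons 0 fun i => (i.castAdd N).succ)).congr fun M x => ?_
    simp
  · refine (UDef.finset_exists (Finset.univ : Finset (Fin N)) fun i =>
      UDef.eq_var 0 (i.natAdd n).succ).congr fun M x => ?_
    simp

/-- Uniform preparation: the preparing set can be chosen uniformly in all leading term parameters,
in the level, and in all models. -/
theorem exists_uniform_preparation (hT : IsHMinimal.{u, v, w} φ 1 T)
    {R : ∀ M : Mod.{u, v, w} φ T, M → M → M → M → M → M → Prop}
    (hR : UDef fun (M : Mod.{u, v, w} φ T) (x : Fin 6 → M) =>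
      R M (x 0) (x 1) (x 2) (x 3) (x 4) (x 5))
    (hinv : LeadingTermInvariant R) :
    ∃ C : ∀ M : Mod.{u, v, w} φ T, M → M → Set M,
      (UDef fun (M : Mod.{u, v, w} φ T) (x : Fin 3 → M) => x 0 ∈ C M (x 1) (x 2)) ∧
      ∀ (M : Mod.{u, v, w} φ T) (a b : M), (C M a b).Finite ∧ (C M a b).Nonempty ∧
        ∀ t l z : M, l ≠ 0 → M.O.valuation l ≤ 1 → ∀ x x',
          SameClass M.O l (C M a b) x x' → (R M x a b t l z ↔ R M x' a b t l z) := by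
  classical
  let A : L.Formula (Fin 3) → ∀ M : Mod.{u, v, w} φ T, M → M → Set M :=
    fun ψ M a b => {x | ψ.Realize ![x, a, b]}
  have hA : ∀ ψ, UDef fun (M : Mod.{u, v, w} φ T) (x : Fin 3 → M) => x 0 ∈ A ψ M (x 1) (x 2) :=
    fun ψ => ⟨ψ, fun M x => by
      simp only [A, Set.mem_ofPred_eq]; congr! 1; ext i; fin_cases i <;> rfl⟩
  let B : L.Formula (Fin 3) × ℕ → ∀ M : Mod.{u, v, w} φ T, M → M → Prop :=
    fun j M a b => ∃ y : Fin j.2 → M, ∀ c, c ∈ A j.1 M a b → ∃ i, c = y i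
  have hB : ∀ j, UDef fun (M : Mod.{u, v, w} φ T) (x : Fin 2 → M) => B j M (x 0) (x 1) :=
    fun j => udef_finite_le (C := fun M x => A j.1 M (x 0) (x 1)) (hA j.1) j.2
  have hBfin : ∀ j M a b, B j M a b → (A j.1 M a b).Finite := by
    rintro j M a b ⟨y, hy⟩
    refine (Set.finite_range y).subset fun c hc => ?_
    obtain ⟨i, rfl⟩ := hy c hc
    exact ⟨i, rfl⟩
  obtain ⟨s, hs⟩ := UDef.compactness (n := 5) hT
    (J := ULift.{max u v w} (L.Formula (Fin 3) × ℕ))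
    (S := fun M x => x 3 ≠ 0 ∧ M.O.valuation (x 3) ≤ M.O.valuation 1)
    (P := fun j M x => B j.down M (x 0) (x 1) ∧
      ∀ y y', SameClass M.O (x 3) (A j.down.1 M (x 0) (x 1)) y y' →
        (R M y (x 0) (x 1) (x 2) (x 3) (x 4) ↔ R M y' (x 0) (x 1) (x 2) (x 3) (x 4)))
    ((UDef.eq (UFun.var 3) UFun.zero).not.and (UDef.val_le (UFun.var 3) UFun.one))
    (fun j => by
      refine (UDef.comp₂ (hB j.down) (UFun.var 0) (UFun.var 1)).and (UDef.all (UDef.all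
        (UDef.imp ?_ (UDef.iff ?_ ?_))))
      · exact UDef.sameClass (C := fun M x => A j.down.1 M (x 2) (x 3))
          (UDef.comp₃ (R := fun M x y z => x ∈ A j.down.1 M y z) (hA j.down.1) (UFun.var 0)
            (UFun.var 3) (UFun.var 4)) (UFun.var 5) (UFun.var 1) (UFun.var 0)
      · exact hR.relabel ![1, 2, 3, 4, 5, 6]
      · exact hR.relabel ![0, 2, 3, 4, 5, 6])
    (by
      rintro M x ⟨h0, h1⟩
      rw [map_one] at h1
      obtain ⟨ψ, hfin, hprep⟩ := exists_formula_prepares hT hR hinv M (x 0) (x 1) (x 2) (x 3) (x 4)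
        h0 h1
      obtain ⟨N, y, hy⟩ := hfin.fin_param
      refine ⟨⟨ψ, N⟩, ⟨y, fun c hc => ?_⟩, hprep⟩
      have : c ∈ Set.range y := by rw [hy.2]; exact hc
      obtain ⟨i, rfl⟩ := this
      exact ⟨i, rfl⟩)
  -- The guard `B` discards a formula for those `a`, `b` where its cardinality bound fails; the
  -- point `0` ensures that the set is nonempty.
  refine ⟨fun M a b => {x | x = 0 ∨ ∃ j ∈ s, B j.down M a b ∧ x ∈ A j.down.1 M a b}, ?_, ?_⟩
  · refine (UDef.eq (UFun.var 0) UFun.zero).or (UDef.finset_exists s fun j => ?_)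
    exact (UDef.comp₂ (hB j.down) (UFun.var 1) (UFun.var 2)).and (hA j.down.1)
  · refine fun M a b => ⟨?_, ⟨0, Or.inl rfl⟩, ?_⟩
    · refine ((Set.finite_singleton (0 : M)).union (s.finite_toSet.biUnion (t := fun j =>
        {x | B j.down M a b ∧ x ∈ A j.down.1 M a b}) fun j _ => ?_)).subset ?_
      · by_cases h : B j.down M a b
        · exact (hBfin _ _ _ _ h).subset fun x hx => hx.2
        · convert Set.finite_empty
          ext x; simp [h]
      · rintro x (rfl | ⟨j, hj, h⟩)
        · exact Or.inl rfl
        · exact Or.inr (Set.mem_biUnion (Finset.mem_coe.2 hj) h)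
    · intro t l z h0 h1 x x' hx
      obtain ⟨j, hj, hBj, hprep⟩ := hs M ![a, b, t, l, z] ⟨h0, by simpa using h1⟩
      exact hprep x x' (hx.anti fun c hc => Or.inr ⟨j, hj, hBj, hc⟩)

end Preparation

/-! ### Slopes of secants -/

section Slopes

variable {K : Type w} [Field K] (O : ValuationSubring K) (F : K → K)

/-- `C` prepares, at all levels, the sets defined by `R`, for all values of the leading term
parameters of `R`. -/
def PreparesFamily (C : Set K) (R : K → K → K → K → Prop) : Prop :=
  C.Finite ∧ C.Nonempty ∧ ∀ t l z : K, l ≠ 0 → O.valuation l ≤ 1 → ∀ x x',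
    SameClass O l C x x' → (R x t l z ↔ R x' t l z)

/-- Some secant starting at `x`, of leading term `rv e`, has a slope close to `z`. -/
def SecantAt (x e l z : K) : Prop :=
  ∃ x', Close O 1 (x' - x) e ∧ Close O l (z * (x' - x)) (F x' - F x)

/-- All secants inside the open ball of radius `|e|` around `x` have slopes close to `z`. -/
def SecantBall (x e l z : K) : Prop :=
  ∀ y y', O.valuation (y - x) < O.valuation e → O.valuation (y' - x) < O.valuation e →
    Close O l (z * (y - y')) (F y - F y')

variable {O F}

theorem PreparesFamily.mono {C D : Set K} {R : K → K → K → K → Prop} (h : PreparesFamily O C R)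
    (hCD : C ⊆ D) (hD : D.Finite) : PreparesFamily O D R :=
  ⟨hD, h.2.1.mono hCD, fun t l z h0 h1 x x' hx => h.2.2 t l z h0 h1 x x' (hx.anti hCD)⟩

/-- Each secant moves by `q - p` up to a smaller error and changes `F - z·id` by less than `|l z (q
- p)|`; the ultrametric inequality prevents the errors from accumulating. The alternative of
equality is needed when `z = 0`, where the strict bound is void. -/
theorem SameClass.exists_chain {C : Set K} {l z p q : K} (hl : O.valuation l ≤ 1)
    (hpq : SameClass O l C p q) (hne : p ≠ q)
    (hS : ∀ x, SameClass O l C p x → SecantAt O F x (q - p) l z) (n : ℕ) :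
    ∃ x, SameClass O l C p x ∧ O.valuation (x - p - n * (q - p)) < O.valuation (q - p) ∧
      (F x - z * x = F p - z * p ∨
        O.valuation (F x - z * x - (F p - z * p)) < O.valuation (l * (z * (q - p)))) := by
  have hqp : q - p ≠ 0 := sub_ne_zero.2 hne.symm
  induction n with
  | zero => exact ⟨p, SameClass.refl _ _ _, by simpa [zero_lt_iff] using hqp, Or.inl rfl⟩
  | succ n ih =>
    obtain ⟨x, hx, hxn, hxh⟩ := ih
    obtain ⟨x', hx'1, hx'2⟩ := hS x hx
    have hv := hx'1.val_eq (by simp)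
    refine ⟨x', SameClass.of_le hl hpq hx hne (q := x') ?_, ?_, ?_⟩
    · rw [Valuation.map_sub_swap, hv, Valuation.map_sub_swap]
    · have e1 : x' - p - ((n + 1 : ℕ) : K) * (q - p) =
          (x - p - n * (q - p)) + (x' - x - (q - p)) := by push_cast; ring
      rw [e1]
      refine Valuation.map_add_lt _ hxn ?_
      rcases hx'1 with h | h
      · rw [h, sub_self, map_zero, zero_lt_iff]; simpa using hqp
      · rwa [one_mul, hv] at h
    · have e2 : F x' - z * x' - (F p - z * p) =
          (F x - z * x - (F p - z * p)) - (z * (x' - x) - (F x' - F x)) := by ring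
      have hv2 : O.valuation (l * (z * (x' - x))) = O.valuation (l * (z * (q - p))) := by
        simp only [map_mul, hv]
      rcases hx'2 with h | h
      · rw [h, sub_self, sub_zero] at e2
        rw [e2]
        refine hxh.imp (fun h' => ?_) id
        rw [h', sub_self, sub_eq_zero] at e2
        exact e2
      · rw [hv2] at h
        right
        rw [e2]
        rcases hxh with h' | h'
        · rw [h', sub_self, zero_sub, Valuation.map_neg]; exact h
        · exact Valuation.map_sub_lt _ h' h

/-- The set `C'` prepares the deviation `h` at every level. On a ball that avoids `C'`, a secant
with bad slope would contradict preparation at the level defined by its own relative variation of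
`h`. -/
theorem secantBall_of_chain {C' : Set K} {l z p e x : K}
    (hC' : PreparesFamily O C' fun x _ l ζ => Close O l (F x - z * x - (F p - z * p)) ζ)
    (hav : ∀ c ∈ C', O.valuation e ≤ O.valuation (x - c))
    (hx : F x - z * x = F p - z * p ∨
        O.valuation (F x - z * x - (F p - z * p)) < O.valuation (l * (z * e))) :
    SecantBall O F x e l z := by
  set h : K → K := fun x => F x - z * x - (F p - z * p) with hh
  have hx' : h x = 0 ∨ O.valuation (h x) < O.valuation (l * (z * e)) := by
    simpa only [hh, sub_eq_zero] using hx
  have hdist : ∀ y, O.valuation (y - x) < O.valuation e → ∀ c ∈ C',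
      O.valuation e ≤ O.valuation (y - c) := by
    intro y hy c hc
    have h1 := hy.trans_le (hav c hc)
    have h2 := Valuation.map_add_eq_of_lt_left O.valuation h1
    rw [sub_add_sub_cancel'] at h2
    rw [h2]; exact hav c hc
  have hcl : ∀ y, O.valuation (y - x) < O.valuation e → Close O 1 (h y) (h x) := by
    intro y hy
    refine (hC'.2.2 0 1 (h x) one_ne_zero (by simp) y x (sameClass_of_lt fun c hc => ?_)).2
      (Close.refl _ _)
    rw [one_mul]
    exact hy.trans_le (hdist y hy c hc)
  intro y y' hy hy'
  by_contra hcon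
  have hval := (hcl y hy).val_eq (by simp)
  have hclyy := (hcl y hy).trans (by simp) ((hcl y' hy').symm (by simp))
  have hd : z * (y - y') - (F y - F y') = -(h y - h y') := by simp only [hh]; ring
  rw [Close, not_or, not_lt, ← sub_eq_zero, hd, Valuation.map_neg, neg_eq_zero, sub_eq_zero] at hcon
  obtain ⟨hne, hle⟩ := hcon
  have hlt := hclyy.lt_of_ne hne
  rw [one_mul] at hlt
  have hy0 : h y ≠ 0 := by
    intro h0
    rw [h0, Close.zero_iff] at hclyy
    exact hne (h0.trans hclyy.symm)
  have hρ : O.valuation (h y) < O.valuation (l * (z * e)) := by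
    rw [hval]
    refine hx'.resolve_left fun h0 => hy0 ?_
    rwa [h0, map_zero, map_eq_zero] at hval
  have hyy : y ≠ y' := fun h => hne (by rw [h])
  -- At level `|l'|` the points `y`, `y'` are in one class because `|h y| < |l z e|` and the slope
  -- is bad. Yet equality of the leading terms of `h y` and `h y'` at this level would give `|h y -
  -- h y'| < |h y - h y'|`.
  set l' : K := (h y - h y') / h y with hl'
  have hpos : 0 < O.valuation (h y) := by simpa [zero_lt_iff] using hy0
  have hl'0 : l' ≠ 0 := div_ne_zero (sub_ne_zero.2 hne) hy0
  have hl'1 : O.valuation l' ≤ 1 := by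
    rw [hl', map_div₀, div_le_one₀ hpos]; exact hlt.le
  have hlt2 : O.valuation (y - y') < O.valuation (l' * e) := by
    have hyy0 : 0 < O.valuation (y - y') := by
      rw [zero_lt_iff]; simpa [sub_eq_zero] using hyy
    have e1 : l' * e = (h y - h y') * e / h y := by rw [hl']; ring
    rw [e1, map_div₀, lt_div_iff₀ hpos]
    calc O.valuation (y - y') * O.valuation (h y)
        < O.valuation (y - y') * O.valuation (l * (z * e)) := mul_lt_mul_of_pos_left hρ hyy0
      _ = O.valuation (l * (z * (y - y'))) * O.valuation e := by
          simp only [map_mul]; ac_rfl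
      _ ≤ O.valuation (h y - h y') * O.valuation e := mul_le_mul_left hle _
      _ = _ := (map_mul _ _ _).symm
  have hs : SameClass O l' C' y y' := sameClass_of_lt fun c hc => hlt2.trans_le (by
    rw [map_mul, map_mul]
    exact mul_le_mul_right (hdist y hy c hc) _)
  have hfin := (hC'.2.2 0 l' (h y) hl'0 hl'1 y y' hs).1 (Close.refl _ _)
  have := (hfin.symm hl'1).lt_of_ne hne
  rw [hl', div_mul_cancel₀ _ hy0] at this
  exact lt_irrefl _ this

/-- The hypotheses on `C` under which the slopes of `F` are controlled. -/
structure ControlsSlopes (O : ValuationSubring K) (F : K → K) (C : Set K) : Prop where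
  secantAt : PreparesFamily O C (SecantAt O F)
  secantBall : PreparesFamily O C (SecantBall O F)
  exists_prep : ∀ z p, ∃ C' : Set K,
    PreparesFamily O C' fun x _ l ζ => Close O l (F x - z * x - (F p - z * p)) ζ

variable [CharZero (IsLocalRing.ResidueField O)]

theorem ControlsSlopes.secantBall_of_sameClass {C : Set K} (hC : ControlsSlopes O F C)
    {l p q r : K} (hl0 : l ≠ 0) (hl : O.valuation l ≤ 1) (hpq : SameClass O l C p q) (hne : p ≠ q)
    (hr : SameClass O l C p r) :
    SecantBall O F r (q - p) l ((F q - F p) / (q - p)) := by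
  have hqp : q - p ≠ 0 := sub_ne_zero.2 hne.symm
  set z := (F q - F p) / (q - p) with hz
  have h0 : SecantAt O F p (q - p) l z :=
    ⟨q, Close.refl _ _, Or.inl (by rw [hz, div_mul_cancel₀ _ hqp])⟩
  obtain ⟨C', hC'⟩ := hC.exists_prep z p
  obtain ⟨n, -, hn⟩ := exists_nat_avoid (O := O) hC'.1 p (q - p)
  obtain ⟨x, hx, hxn, hxh⟩ := SameClass.exists_chain (F := F) (z := z) hl hpq hne
    (fun x hx => (hC.secantAt.2.2 _ l z hl0 hl p x hx).1 h0) n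
  refine (hC.secantBall.2.2 _ l z hl0 hl x r ((hx.symm hl).trans hl hr)).1
    (secantBall_of_chain hC' (fun c hc => ?_) hxh)
  have h1 := hxn.trans_le (hn c hc)
  have h2 := Valuation.map_sub_eq_of_lt_left O.valuation h1
  have e1 : c - p - n * (q - p) - (x - p - n * (q - p)) = c - x := by ring
  rw [e1, Valuation.map_sub_swap] at h2
  rw [h2]; exact hn c hc

/-- Slopes of secants inside a class of level `|l|` are close to each other. -/
theorem ControlsSlopes.close_slope {C : Set K} (hC : ControlsSlopes O F C) (hO : O ≠ ⊤)
    {l p q r s : K} (hl0 : l ≠ 0) (hl : O.valuation l ≤ 1) (hpq : SameClass O l C p q)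
    (hne : p ≠ q) (hr : SameClass O l C p r) (hs : SameClass O l C p s) (hrs : r ≠ s) :
    Close O l ((F q - F p) / (q - p) * (r - s)) (F r - F s) := by
  have hqp : q - p ≠ 0 := sub_ne_zero.2 hne.symm
  have hrs' : r - s ≠ 0 := sub_ne_zero.2 hrs
  -- The secant from `p` to `p + e` is short enough to be controlled by both given secants, so it
  -- links their slopes.
  obtain ⟨e, he0, he1, he2⟩ : ∃ e : K, e ≠ 0 ∧ O.valuation e < O.valuation (q - p) ∧
      O.valuation e < O.valuation (r - s) := by
    rcases le_total (O.valuation (q - p)) (O.valuation (r - s)) with h | h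
    · obtain ⟨e, he, h'⟩ := exists_val_lt hO hqp
      exact ⟨e, he, h', h'.trans_le h⟩
    · obtain ⟨e, he, h'⟩ := exists_val_lt hO hrs'
      exact ⟨e, he, h'.trans_le h, h'⟩
  have key : ∀ a b : K, SameClass O l C a b → a ≠ b → SameClass O l C a p →
      O.valuation e < O.valuation (b - a) →
      Close O l ((F b - F a) / (b - a)) ((F (p + e) - F p) / e) := by
    intro a b hab hne' hap hlt
    have hba : b - a ≠ 0 := sub_ne_zero.2 hne'.symm
    have := hC.secantBall_of_sameClass hl0 hl hab hne' hap (p + e) p (by simpa using hlt)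
      (by simpa [zero_lt_iff] using hba)
    rw [add_sub_cancel_left] at this
    refine Close.cancel_right he0 ?_
    rwa [div_mul_cancel₀ (F (p + e) - F p) he0]
  have h1 := key p q hpq hne (SameClass.refl _ _ _) he1
  have h2 := key s r ((hs.symm hl).trans hl hr) hrs.symm (hs.symm hl) he2
  have h3 := (h1.trans hl (h2.symm hl)).mul_right (r - s)
  rwa [div_mul_cancel₀ (F r - F s) hrs'] at h3

end Slopes

/-! ### Existence of the derivative -/

section Derivative

variable {K : Type w} [Field K] (O : ValuationSubring K) (F : K → K)

/-- `y` approximates all slopes at `x₀` inside the class of `x₀` of level `|l|`. -/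
def ApproxSlope (C : Set K) (x₀ l y : K) : Prop :=
  ∀ x, x ≠ x₀ → SameClass O l C x₀ x → Close O l (y * (x - x₀)) (F x - F x₀)

variable {O F} {C D : Set K} {x₀ : K}

theorem exists_radius (hC : C.Finite) (hne : C.Nonempty) (hx₀ : x₀ ∉ C) {l : K} (hl : l ≠ 0) :
    ∃ g : K, g ≠ 0 ∧ ∀ y, O.valuation (x₀ - y) < O.valuation g → SameClass O l C x₀ y := by
  obtain ⟨c, hc, hmin⟩ := exists_nearest (O := O) hC hne x₀
  refine ⟨l * (x₀ - c), mul_ne_zero hl (sub_ne_zero.2 fun h => hx₀ (h ▸ hc)), fun y hy =>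
    sameClass_of_lt fun c' hc' => hy.trans_le ?_⟩
  rw [map_mul, map_mul]
  exact mul_le_mul_right (hmin c' hc') _

theorem exists_ne_sameClass (hO : O ≠ ⊤) (hC : C.Finite) (hne : C.Nonempty) (hx₀ : x₀ ∉ C) {l : K}
    (hl : l ≠ 0) : ∃ x, x ≠ x₀ ∧ SameClass O l C x₀ x := by
  obtain ⟨g, hg, h⟩ := exists_radius (O := O) hC hne hx₀ hl
  obtain ⟨e, he, hlt⟩ := exists_val_lt hO hg
  exact ⟨x₀ + e, by simpa using he, h _ (by rwa [Valuation.map_sub_swap, add_sub_cancel_left])⟩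

theorem hasDeriv_of_approxSlope (hC : C.Finite) (hne : C.Nonempty) (hx₀ : x₀ ∉ C) {a : K}
    (h : ∀ l, l ≠ 0 → O.valuation l ≤ 1 → ApproxSlope O F C x₀ l a) : HasDeriv O F x₀ a := by
  intro ε
  obtain ⟨e, he0, he⟩ := exists_val_eq ε
  -- Closeness is relative to `|a|`, whereas the derivative needs absolute precision `|e|`; hence
  -- the bound `|l a| ≤ |e|`.
  obtain ⟨l, hl0, hl1, hla⟩ : ∃ l : K, l ≠ 0 ∧ O.valuation l ≤ 1 ∧
      O.valuation (l * a) ≤ O.valuation e := by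
    by_cases hae : O.valuation a ≤ O.valuation e
    · exact ⟨1, one_ne_zero, by simp, by simpa using hae⟩
    · rw [not_le] at hae
      have ha : a ≠ 0 := by rintro rfl; simp at hae
      refine ⟨e / a, div_ne_zero he0 ha, ?_, by rw [div_mul_cancel₀ _ ha]⟩
      rw [map_div₀, div_le_one₀ (by simpa [zero_lt_iff] using ha)]
      exact hae.le
  obtain ⟨g, hg0, hg⟩ := exists_radius (O := O) hC hne hx₀ hl0
  refine ⟨Units.mk0 (O.valuation g) (by simpa using hg0), fun y hy hxy => ?_⟩
  have hyx : y - x₀ ≠ 0 := sub_ne_zero.2 hxy.symm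
  have h1 := h l hl0 hl1 y hxy.symm (hg y hy)
  have h2 : Close O l a ((F y - F x₀) / (y - x₀)) := by
    refine Close.cancel_right hyx ?_
    rwa [div_mul_cancel₀ _ hyx]
  have e1 : (F x₀ - F y) / (x₀ - y) = (F y - F x₀) / (y - x₀) := by
    rw [← neg_sub (F y), ← neg_sub y, neg_div_neg_eq]
  rw [e1, ← he]
  rcases h2 with h2 | h2
  · rw [← h2, sub_self, map_zero, zero_lt_iff]
    simpa using he0
  · rw [Valuation.map_sub_swap]
    exact h2.trans_le hla

variable [CharZero (IsLocalRing.ResidueField O)]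

theorem ControlsSlopes.approxSlope_of_close (hC : ControlsSlopes O F C) (hO : O ≠ ⊤) {l x y : K}
    (hl0 : l ≠ 0) (hl : O.valuation l ≤ 1) (hx : x ≠ x₀) (hxx : SameClass O l C x₀ x)
    (h : Close O l (y * (x - x₀)) (F x - F x₀)) : ApproxSlope O F C x₀ l y := by
  intro x' hx' hxx'
  have hne : x - x₀ ≠ 0 := sub_ne_zero.2 hx
  have h1 : Close O l y ((F x - F x₀) / (x - x₀)) := by
    refine Close.cancel_right hne ?_
    rwa [div_mul_cancel₀ _ hne]
  exact (h1.mul_right (x' - x₀)).trans hl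
    (hC.close_slope hO hl0 hl hxx hx.symm hxx' (SameClass.refl _ _ _) hx')

/-- If no slope worked at all levels, each point of `D` would be excluded at some level. At the
smallest of these the approximate slopes lie in one class of `D`, which cannot be subdivided at
finer levels, although the approximations must become arbitrarily precise. -/
theorem ControlsSlopes.exists_approxSlope (hC : ControlsSlopes O F C) (hO : O ≠ ⊤) (hx₀ : x₀ ∉ C)
    (hD : PreparesFamily O D fun y t _ _ => ApproxSlope O F C x₀ t y) :
    ∃ a, ∀ l, l ≠ 0 → O.valuation l ≤ 1 → ApproxSlope O F C x₀ l a := by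
  have hCf := hC.secantAt.1
  have hCn := hC.secantAt.2.1
  have hex : ∀ l : K, l ≠ 0 → O.valuation l ≤ 1 → ∃ y, ApproxSlope O F C x₀ l y := by
    intro l hl0 hl
    obtain ⟨x, hx, hxx⟩ := exists_ne_sameClass hO hCf hCn hx₀ hl0
    refine ⟨(F x - F x₀) / (x - x₀), hC.approxSlope_of_close hO hl0 hl hx hxx (Or.inl ?_)⟩
    rw [div_mul_cancel₀ _ (sub_ne_zero.2 hx)]
  have hmono : ∀ l l' y : K, l ≠ 0 → l' ≠ 0 → O.valuation l ≤ 1 →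
      O.valuation l' ≤ O.valuation l → ApproxSlope O F C x₀ l' y → ApproxSlope O F C x₀ l y := by
    intro l l' y hl0 hl'0 hl hll h
    obtain ⟨x, hx, hxx⟩ := exists_ne_sameClass hO hCf hCn hx₀ hl'0
    exact hC.approxSlope_of_close hO hl0 hl hx (hxx.mono hll) ((h x hx hxx).mono hll)
  have hclose : ∀ l y y' : K, l ≠ 0 → O.valuation l ≤ 1 → ApproxSlope O F C x₀ l y →
      ApproxSlope O F C x₀ l y' → Close O l y y' := by
    intro l y y' hl0 hl h h'
    obtain ⟨x, hx, hxx⟩ := exists_ne_sameClass hO hCf hCn hx₀ hl0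
    exact ((h x hx hxx).trans hl ((h' x hx hxx).symm hl)).cancel_right (sub_ne_zero.2 hx)
  have hball : ∀ l y y' : K, l ≠ 0 → O.valuation l ≤ 1 → ApproxSlope O F C x₀ l y →
      Close O l y y' → ApproxSlope O F C x₀ l y' := by
    intro l y y' hl0 hl h h' x hx hxx
    exact ((h'.mul_right _).symm hl).trans hl (h x hx hxx)
  by_contra! hcon
  choose! g hg0 hg1 hg using hcon
  obtain ⟨d₀, hd₀, hmin⟩ := Set.exists_min_image D (fun d => O.valuation (g d)) hD.1 hD.2.1
  set l := g d₀ with hl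
  have hlD : ∀ d ∈ D, ¬ ApproxSlope O F C x₀ l d := fun d hd h =>
    hg d (hmono _ l d (hg0 d) (hg0 d₀) (hg1 d) (hmin d hd) h)
  have hl0 : l ≠ 0 := hg0 d₀
  have hl1 : O.valuation l ≤ 1 := hg1 d₀
  obtain ⟨y, hy⟩ := hex l hl0 hl1
  have hsame : ∀ y', ApproxSlope O F C x₀ l y' → SameClass O 1 D y y' := by
    intro y' hy'
    rcases hclose l y y' hl0 hl1 hy hy' with rfl | hlt
    · exact SameClass.refl _ _ _
    refine sameClass_of_lt fun d hd => ?_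
    rw [one_mul]
    by_contra hle
    rw [not_lt] at hle
    exact hlD d hd (hball l y d hl0 hl1 hy (Or.inr (hle.trans_lt hlt)))
  -- As `D` cannot separate `y` from `y'`, both are approximate slopes at every finer level. The
  -- level `|(y - y') / y|` then distinguishes them.
  obtain ⟨y', hne, hyy'⟩ := exists_ne_sameClass hO hD.1 hD.2.1 (fun h => hlD y h hy)
    (one_ne_zero (α := K))
  have hall : ∀ l' : K, l' ≠ 0 → O.valuation l' ≤ O.valuation l → Close O l' y y' := by
    intro l' hl'0 hl'
    have hl'1 := hl'.trans hl1
    obtain ⟨u, hu⟩ := hex l' hl'0 hl'1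
    have h1 := hsame u (hmono l l' u hl0 hl'0 hl1 hl' hu)
    have h2 := (hD.2.2 l' 1 0 one_ne_zero (by simp) y u h1).2 hu
    have h3 := (hD.2.2 l' 1 0 one_ne_zero (by simp) y y' hyy').1 h2
    exact hclose l' y y' hl'0 hl'1 h2 h3
  have h1 := (hall l hl0 le_rfl).lt_of_ne hne.symm
  have hy0 : y ≠ 0 := by rintro rfl; simp at h1
  have hpos : 0 < O.valuation y := by simpa [zero_lt_iff] using hy0
  have h2 := (hall ((y - y') / y) (div_ne_zero (sub_ne_zero.2 hne.symm) hy0) (by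
    rw [map_div₀, div_le_iff₀ hpos, ← map_mul]
    exact h1.le)).lt_of_ne hne.symm
  rw [div_mul_cancel₀ _ hy0] at h2
  exact lt_irrefl _ h2

end Derivative

/-! ### Images of open balls -/

section Images

variable {K : Type w} [Field K] (O : ValuationSubring K) (F : K → K)

/-- The image of the ball `x + rv e` does not contain the ball `F x + rv z`. -/
def ImageDefect (x e z : K) : Prop :=
  ∃ y, Close O 1 (y - F x) z ∧ ¬ ∃ x', Close O 1 (x' - x) e ∧ F x' = y

variable {O F} {C : Set K}

theorem close_one_iff {x e : K} (he : e ≠ 0) :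
    Close O 1 x e ↔ O.valuation (x - e) < O.valuation e := by
  constructor
  · intro h
    rcases h.symm (by simp) with h | h
    · rw [h, sub_self, map_zero, zero_lt_iff]; simpa [← h] using he
    · rwa [one_mul, Valuation.map_sub_swap] at h
  · intro h
    exact Close.symm (by simp) (Or.inr (by rwa [one_mul, Valuation.map_sub_swap]))

theorem val_secant_lt {z p q x e : K} (he : e ≠ 0) (hz : z ≠ 0)
    (hcl : Close O 1 (z * (x - p)) (F x - F p)) (hx : O.valuation (x - p) ≤ O.valuation e)
    (hq : q = z * (x - p)) :
    O.valuation (F x - F p - q) < O.valuation (z * e) := by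
  subst hq
  rcases hcl with h | h
  · rw [h, sub_self, map_zero, zero_lt_iff]; simp [he, hz]
  · rw [Valuation.map_sub_swap]
    refine h.trans_le ?_
    rw [one_mul, map_mul, map_mul]
    exact mul_le_mul_right hx _

/-- Off `D`, the nearest point of `D` determines the radius of the class. -/
theorem setOf_sameClass_eq {D : Set K} (hD : D.Finite) (hDn : D.Nonempty) (y : K) :
    {y' | SameClass O 1 D y y'} = {y} ∨ IsOpenBall O {y' | SameClass O 1 D y y'} := by
  by_cases hy : y ∈ D
  · left
    ext y'
    simp only [Set.mem_ofPred_eq, Set.mem_singleton_iff]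
    refine ⟨fun h => ?_, fun h => h ▸ SameClass.refl _ _ _⟩
    have := h y hy
    rwa [sub_self, Close.zero_iff, sub_eq_zero] at this
  · right
    obtain ⟨d, hd, hmin⟩ := exists_nearest (O := O) hD hDn y
    have hyd : y - d ≠ 0 := sub_ne_zero.2 fun h => hy (h ▸ hd)
    refine ⟨y, Units.mk0 (O.valuation (y - d)) (by simpa using hyd), ?_⟩
    ext y'
    simp only [Set.mem_ofPred_eq, Units.val_mk0]
    constructor
    · intro h
      by_cases hne : y = y'
      · rw [hne, sub_self, map_zero, zero_lt_iff, ← hne]; simpa using hyd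
      · rw [Valuation.map_sub_swap]
        simpa using h.lt hne hd
    · intro h
      refine sameClass_of_lt fun d' hd' => ?_
      rw [one_mul, Valuation.map_sub_swap]
      exact h.trans_le (hmin d' hd')

variable [CharZero (IsLocalRing.ResidueField O)]

/-- Since `C` prepares defects, a value missed from `p` produces one missed from `p + k e`, located
near `F p + (k + 1) z e`. For suitable `k` the set `D` cannot separate that value from `F (p + (k +
1) e)`, which is attained, so it is attained too. -/
theorem exists_preimage {z p q : K} (hz : z ≠ 0) (hne : p ≠ q) (hpq : SameClass O 1 C p q)
    (hcl : ∀ x y, SameClass O 1 C p x → SameClass O 1 C p y → Close O 1 (z * (x - y)) (F x - F y))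
    (hC : PreparesFamily O C fun x t _ ζ => ImageDefect O F x t ζ)
    {D : Set K} (hD : PreparesFamily O D fun y t _ _ => ∃ x, Close O 1 (x - p) t ∧ F x = y)
    {y : K} (hy : Close O 1 (y - F p) (z * (q - p))) :
    ∃ x, Close O 1 (x - p) (q - p) ∧ F x = y := by
  by_contra hcon
  have hqp : q - p ≠ 0 := sub_ne_zero.2 hne.symm
  set e := q - p with he
  have hze : z * e ≠ 0 := mul_ne_zero hz hqp
  have hdef : ImageDefect O F p e (z * e) := ⟨y, hy, hcon⟩
  obtain ⟨n, hn0, hn⟩ := exists_nat_avoid (O := O) hD.1 (F p) (z * e)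
  obtain ⟨k, rfl⟩ := Nat.exists_eq_succ_of_ne_zero hn0
  have hmul : ∀ m : ℕ, O.valuation (m * e) ≤ O.valuation e := by
    intro m
    by_cases hm : m = 0
    · subst hm; simp
    · rw [map_mul, val_natCast hm, one_mul]
  have hN : ∀ m : ℕ, SameClass O 1 C p (p + m * e) := fun m =>
    SameClass.of_le (p := p) (by simp) hpq (SameClass.refl _ _ _) hne (by
      rw [Valuation.map_sub_swap, add_sub_cancel_left, Valuation.map_sub_swap _ p q]
      exact hmul m)
  have hF : ∀ m : ℕ, O.valuation (F (p + m * e) - F p - z * (m * e)) < O.valuation (z * e) :=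
    fun m => val_secant_lt hqp hz (hcl _ _ (hN m) (SameClass.refl _ _ _))
      (by rw [add_sub_cancel_left]; exact hmul m) (by rw [add_sub_cancel_left])
  obtain ⟨y', hy', hno⟩ := (hC.2.2 e 1 (z * e) one_ne_zero (by simp) p _ (hN k)).1 hdef
  rw [close_one_iff hze] at hy'
  set x' := p + (k + 1 : ℕ) * e with hx'
  have h1 : O.valuation (y' - F p - (k + 1 : ℕ) * (z * e)) < O.valuation (z * e) := by
    have := Valuation.map_add_lt _ hy' (hF k)
    convert this using 2
    push_cast; ring
  have h2 : O.valuation (y' - F x') < O.valuation (z * e) := by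
    have := Valuation.map_sub_lt _ h1 (hF (k + 1))
    convert this using 2
    ring
  have h3 : SameClass O 1 D y' (F x') := sameClass_of_lt fun d hd => by
    rw [one_mul]
    refine h2.trans_le ?_
    have h4 := Valuation.map_sub_eq_of_lt_left O.valuation (h1.trans_le (hn d hd))
    have e1 : d - F p - ((k + 1 : ℕ) : K) * (z * e) - (y' - F p - ((k + 1 : ℕ) : K) * (z * e)) =
      d - y' := by ring
    rw [e1, Valuation.map_sub_swap] at h4
    rw [h4]; exact hn d hd
  obtain ⟨x, hx, hxy⟩ := (hD.2.2 ((k + 1 : ℕ) * e) 1 0 one_ne_zero (by simp) _ _ h3).2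
    ⟨x', by rw [hx', add_sub_cancel_left]; exact Close.refl _ _, rfl⟩
  refine hno ⟨x, ?_, hxy⟩
  have hk0 : ((k + 1 : ℕ) : K) * e ≠ 0 := by
    rw [← O.valuation.ne_zero_iff, map_mul, val_natCast hn0, one_mul]
    simpa using hqp
  rw [close_one_iff hk0, map_mul (O.valuation) ((k + 1 : ℕ) : K), val_natCast hn0, one_mul] at hx
  rw [close_one_iff hqp]
  convert hx using 2
  push_cast; ring

theorem image_ball {z a w : K} (hz : z ≠ 0) (hw : w ≠ 0) (haw : SameClass O 1 C a (a + w))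
    (hcl : ∀ x y, SameClass O 1 C a x → SameClass O 1 C a y → Close O 1 (z * (x - y)) (F x - F y))
    (hC : PreparesFamily O C fun x t _ ζ => ImageDefect O F x t ζ)
    (hD : ∀ p, ∃ D : Set K,
      PreparesFamily O D fun y t _ _ => ∃ x, Close O 1 (x - p) t ∧ F x = y) :
    F '' {x | O.valuation (x - a) < O.valuation w} =
      {y | O.valuation (y - F a) < O.valuation (z * w)} := by
  have h11 : O.valuation (1 : K) ≤ 1 := by simp
  have hmem : ∀ x, O.valuation (x - a) ≤ O.valuation w → SameClass O 1 C a x := fun x hx =>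
    SameClass.of_le (p := a) h11 haw (SameClass.refl _ _ _) (by simpa using hw) (by
      rw [Valuation.map_sub_swap, sub_add_cancel_left, Valuation.map_neg]; exact hx)
  have hp : SameClass O 1 C a (a - w) := hmem _ (by simp)
  have hbase : SameClass O 1 C a a := SameClass.refl _ _ _
  apply Set.Subset.antisymm
  · rintro _ ⟨x, hx, rfl⟩
    rw [Set.mem_ofPred_eq] at hx ⊢
    rw [← (hcl x a (hmem x hx.le) hbase).val_eq h11, map_mul, map_mul]
    exact mul_lt_mul_of_pos_left hx (by simpa [zero_lt_iff] using hz)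
  · intro y hy
    rw [Set.mem_ofPred_eq] at hy
    -- Seen from `a - w`, the open ball of radius `|w|` around `a` is the set of `x` with `rv (x -
    -- (a - w)) = rv w`, the shape handled by `exists_preimage`.
    obtain ⟨D, hD⟩ := hD (a - w)
    obtain ⟨x, hx, hxy⟩ := exists_preimage (F := F) (y := y) hz (by simpa using hw) (hp.symm h11)
      (fun x y hx hy => hcl x y (hp.trans h11 hx) (hp.trans h11 hy)) hC hD (by
        rw [sub_sub_cancel, close_one_iff (mul_ne_zero hz hw)]
        have h1 := val_secant_lt (q := z * w) hw hz (hcl a (a - w) hbase hp) (by simp) (by simp)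
        have := Valuation.map_add_lt _ hy h1
        convert this using 2
        ring)
    rw [sub_sub_cancel, close_one_iff hw] at hx
    refine ⟨x, ?_, hxy⟩
    rw [Set.mem_ofPred_eq]
    convert hx using 2
    ring

/-- Images of open balls inside a class are points or open balls. -/
theorem ControlsSlopes.image_isOpenBall (hCs : ControlsSlopes O F C) (hO : O ≠ ⊤)
    (hC : PreparesFamily O C fun x t _ ζ => ImageDefect O F x t ζ) {D : K → Set K}
    (hD : ∀ p, PreparesFamily O (D p) fun y t _ _ => ∃ x, Close O 1 (x - p) t ∧ F x = y)
    {C' : Set K} (hCC' : C ⊆ C')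
    (hC' : ∀ c ∈ C, ∀ d ∈ D c, ∀ ζ x x', SameClass O 1 C' x x' →
      (Close O 1 (F x - d) ζ ↔ Close O 1 (F x' - d) ζ))
    {p : K} (hp : p ∉ C') {B : Set K} (hB : IsOpenBall O B)
    (hBp : ∀ x ∈ B, SameClass O 1 C' p x) :
    (∃ y, F '' B = {y}) ∨ IsOpenBall O (F '' B) := by
  have h11 : O.valuation (1 : K) ≤ 1 := by simp
  obtain ⟨a, g, rfl⟩ := hB
  obtain ⟨w, hw, hwg⟩ := exists_val_eq g
  rw [← hwg] at hBp ⊢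
  have haB : O.valuation (a - a) < O.valuation w := by
    rw [sub_self, map_zero, zero_lt_iff]; simpa using hw
  have hpa := hBp a haB
  have haC : a ∉ C := fun h => hpa.ne_of_notMem h11 hp (hCC' h)
  have hBa : ∀ x, O.valuation (x - a) < O.valuation w → SameClass O 1 C' a x := fun x hx =>
    (hpa.symm h11).trans h11 (hBp x hx)
  obtain ⟨c, hc, hmin⟩ := exists_nearest (O := O) hC.1 hC.2.1 a
  have hac : a - c ≠ 0 := sub_ne_zero.2 fun h => haC (h ▸ hc)
  have hwle : O.valuation w ≤ O.valuation (a - c) := by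
    by_contra hlt
    rw [not_le, Valuation.map_sub_swap] at hlt
    exact (hBp c hlt).ne_of_notMem h11 hp (hCC' hc)
  rcases hwle.lt_or_eq with hlt | heq
  -- The radius is smaller than the distance to `C`, so `a + w` is still in the class and yields a
  -- reference slope.
  · have haw : SameClass O 1 C a (a + w) := sameClass_of_lt fun c' hc' => by
      rw [one_mul, sub_add_cancel_left, Valuation.map_neg]
      exact hlt.trans_le (hmin c' hc')
    have hne : a ≠ a + w := by simpa using hw
    set z := (F (a + w) - F a) / (a + w - a) with hz
    have hcl : ∀ x y, SameClass O 1 C a x → SameClass O 1 C a y →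
        Close O 1 (z * (x - y)) (F x - F y) := by
      intro x y hx hy
      by_cases hxy : x = y
      · subst hxy; simp [Close]
      · exact hCs.close_slope hO one_ne_zero h11 haw hne hx hy hxy
    by_cases hz0 : z = 0
    · left
      refine ⟨F a, Set.Subset.antisymm ?_ ?_⟩
      · rintro _ ⟨x, hx, rfl⟩
        have := hcl x a ((hBa x hx).anti hCC') (SameClass.refl _ _ _)
        rw [hz0, zero_mul, Close.zero_iff, sub_eq_zero] at this
        exact this
      · rintro _ rfl
        exact ⟨a, haB, rfl⟩
    · right
      rw [image_ball hz0 hw haw hcl hC fun p => ⟨D p, hD p⟩]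
      refine ⟨F a, Units.mk0 (O.valuation (z * w)) (by simp [hz0, hw]), rfl⟩
  -- Here the ball is all of `{x | rv (x - c) = rv (a - c)}`. Its image is a union of classes of `D
  -- c` by `hD`, and lies in a single one by `hC'`.
  · have himg : F '' {x | O.valuation (x - a) < O.valuation w} =
        {y | SameClass O 1 (D c) (F a) y} := by
      apply Set.Subset.antisymm
      · rintro _ ⟨x, hx, rfl⟩ d hd
        exact ((hC' c hc d hd (F a - d) a x (hBa x hx)).1 (Close.refl _ _)).symm h11
      · intro y hy
        obtain ⟨x, hx, hxy⟩ := ((hD c).2.2 (a - c) 1 0 one_ne_zero h11 _ _ hy).1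
          ⟨a, Close.refl _ _, rfl⟩
        rw [close_one_iff hac, sub_sub_sub_cancel_right, ← heq] at hx
        exact ⟨x, hx, hxy⟩
    rw [himg]
    exact (setOf_sameClass_eq (hD c).1 (hD c).2.1 (F a)).imp (fun h => ⟨_, h⟩) id

end Images

/-! ### The prepared families, and assembly of the theorem -/

section Families

variable {L : FirstOrder.Language.{u, v}} {φ : langVal →ᴸ L} {T : L.Theory}

theorem exists_preparesFamily (hT : IsHMinimal.{u, v, w} φ 1 T)
    {R : ∀ M : Mod.{u, v, w} φ T, M → M → M → M → M → M → Prop}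
    (hR : UDef fun (M : Mod.{u, v, w} φ T) (x : Fin 6 → M) =>
      R M (x 0) (x 1) (x 2) (x 3) (x 4) (x 5))
    (hinv : LeadingTermInvariant R) :
    ∃ C : ∀ M : Mod.{u, v, w} φ T, M → M → Set M,
      (UDef fun (M : Mod.{u, v, w} φ T) (x : Fin 3 → M) => x 0 ∈ C M (x 1) (x 2)) ∧
      ∀ (M : Mod.{u, v, w} φ T) (a b : M),
        PreparesFamily M.O (C M a b) fun x t l z => R M x a b t l z := by
  obtain ⟨C, hC, h⟩ := exists_uniform_preparation hT hR hinv
  exact ⟨C, hC, fun M a b => ⟨(h M a b).1, (h M a b).2.1, (h M a b).2.2⟩⟩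

theorem exists_preparesFamily₀ (hT : IsHMinimal.{u, v, w} φ 1 T)
    {R : ∀ M : Mod.{u, v, w} φ T, M → M → M → M → Prop}
    (hR : UDef fun (M : Mod.{u, v, w} φ T) (x : Fin 4 → M) => R M (x 0) (x 1) (x 2) (x 3))
    (hinv : LeadingTermInvariant fun (M : Mod.{u, v, w} φ T) x _ _ t l z => R M x t l z) :
    ∃ C : ∀ M : Mod.{u, v, w} φ T, Set M,
      (UDef fun (M : Mod.{u, v, w} φ T) (x : Fin 1 → M) => x 0 ∈ C M) ∧
      ∀ M : Mod.{u, v, w} φ T, PreparesFamily M.O (C M) (R M) := by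
  obtain ⟨C, hC, h⟩ := exists_preparesFamily hT
    (R := fun M x _ _ t l z => R M x t l z) (hR.relabel ![0, 3, 4, 5]) hinv
  exact ⟨fun M => C M 0 0, UDef.comp₃ (R := fun M x a b => x ∈ C M a b) hC (UFun.var 0) UFun.zero
    UFun.zero, fun M => h M 0 0⟩

variable {F : ∀ M : Mod.{u, v, w} φ T, M → M}
  (hF : UFun fun (M : Mod.{u, v, w} φ T) (x : Fin 1 → M) => F M (x 0))

include hF

theorem exists_prepares_secantAt (hT : IsHMinimal.{u, v, w} φ 1 T) :
    ∃ C : ∀ M : Mod.{u, v, w} φ T, Set M,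
      (UDef fun (M : Mod.{u, v, w} φ T) (x : Fin 1 → M) => x 0 ∈ C M) ∧
      ∀ M : Mod.{u, v, w} φ T, PreparesFamily M.O (C M) (SecantAt M.O (F M)) := by
  refine exists_preparesFamily₀ hT (UDef.ex (UDef.and ?_ ?_)) ?_
  · exact UDef.close UFun.one (UFun.sub (UFun.var 0) (UFun.var 1)) (UFun.var 2)
  · exact UDef.close (UFun.var 3) (UFun.mul (UFun.var 4) (UFun.sub (UFun.var 0) (UFun.var 1)))
      (UFun.sub (UFun.comp₁ hF (UFun.var 0)) (UFun.comp₁ hF (UFun.var 1)))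
  · rintro M - - t t' l l' z z' x - hl ht hll hz ⟨x', h1, h2⟩
    refine ⟨x', h1.trans (by simp) ht, ?_⟩
    rw [← close_iff_of_val_eq (hll.val_eq (by simp))]
    exact ((hz.mul_right _).symm hl).trans hl h2

theorem exists_prepares_secantBall (hT : IsHMinimal.{u, v, w} φ 1 T) :
    ∃ C : ∀ M : Mod.{u, v, w} φ T, Set M,
      (UDef fun (M : Mod.{u, v, w} φ T) (x : Fin 1 → M) => x 0 ∈ C M) ∧
      ∀ M : Mod.{u, v, w} φ T, PreparesFamily M.O (C M) (SecantBall M.O (F M)) := by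
  refine exists_preparesFamily₀ hT (UDef.all (UDef.all (UDef.imp ?_ (UDef.imp ?_ ?_)))) ?_
  · exact UDef.val_lt (UFun.sub (UFun.var 1) (UFun.var 2)) (UFun.var 3)
  · exact UDef.val_lt (UFun.sub (UFun.var 0) (UFun.var 2)) (UFun.var 3)
  · exact UDef.close (UFun.var 4) (UFun.mul (UFun.var 5) (UFun.sub (UFun.var 1) (UFun.var 0)))
      (UFun.sub (UFun.comp₁ hF (UFun.var 1)) (UFun.comp₁ hF (UFun.var 0)))
  · intro M _ _ t t' l l' z z' x _ hl ht hll hz h y y' hy hy'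
    rw [← ht.val_eq (by simp)] at hy hy'
    rw [← close_iff_of_val_eq (hll.val_eq (by simp))]
    exact ((hz.mul_right _).symm hl).trans hl (h y y' hy hy')

theorem exists_prepares_linear (hT : IsHMinimal.{u, v, w} φ 1 T) (M : Mod.{u, v, w} φ T)
    (z p : M) : ∃ C : Set M, PreparesFamily M.O C fun x _ l ζ =>
      Close M.O l (F M x - z * x - (F M p - z * p)) ζ := by
  refine (exists_preparesFamily hT
    (R := fun M x z p _ l ζ => Close M.O l (F M x - z * x - (F M p - z * p)) ζ) ?_ ?_).elim
    fun C ⟨_, h⟩ => ?_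
  · exact UDef.close (UFun.var 4) (UFun.sub
      (UFun.sub (UFun.comp₁ hF (UFun.var 0)) (UFun.mul (UFun.var 1) (UFun.var 0)))
      (UFun.sub (UFun.comp₁ hF (UFun.var 2)) (UFun.mul (UFun.var 1) (UFun.var 2)))) (UFun.var 5)
  · intro M _ _ t t' l l' z z' x _ hl ht hll hz h
    rw [← close_iff_of_val_eq (hll.val_eq (by simp))]
    exact h.trans hl hz
  · exact ⟨C M z p, h M z p⟩

theorem exists_prepares_imageDefect (hT : IsHMinimal.{u, v, w} φ 1 T) :
    ∃ C : ∀ M : Mod.{u, v, w} φ T, Set M,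
      (UDef fun (M : Mod.{u, v, w} φ T) (x : Fin 1 → M) => x 0 ∈ C M) ∧
      ∀ M : Mod.{u, v, w} φ T,
        PreparesFamily M.O (C M) fun x t _ ζ => ImageDefect M.O (F M) x t ζ := by
  refine exists_preparesFamily₀ hT (UDef.ex (UDef.and ?_ (UDef.not (UDef.ex (UDef.and ?_ ?_))))) ?_
  · exact UDef.close UFun.one (UFun.sub (UFun.var 0) (UFun.comp₁ hF (UFun.var 1))) (UFun.var 4)
  · exact UDef.close UFun.one (UFun.sub (UFun.var 0) (UFun.var 2)) (UFun.var 3)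
  · exact UDef.eq (UFun.comp₁ hF (UFun.var 0)) (UFun.var 1)
  · rintro M - - t t' l l' z z' x - hl ht - hz ⟨y, h1, h2⟩
    refine ⟨y, h1.trans (by simp) (hz.one hl), fun ⟨x', h3, h4⟩ => h2 ⟨x', ?_, h4⟩⟩
    exact h3.trans (by simp) (ht.symm (by simp))

theorem exists_prepares_image (hT : IsHMinimal.{u, v, w} φ 1 T) :
    ∃ D : ∀ M : Mod.{u, v, w} φ T, M → Set M,
      (UDef fun (M : Mod.{u, v, w} φ T) (x : Fin 2 → M) => x 0 ∈ D M (x 1)) ∧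
      ∀ (M : Mod.{u, v, w} φ T) (p : M),
        PreparesFamily M.O (D M p) fun y t _ _ => ∃ x, Close M.O 1 (x - p) t ∧ F M x = y := by
  refine (exists_preparesFamily hT
    (R := fun M y p _ t _ _ => ∃ x, Close M.O 1 (x - p) t ∧ F M x = y) ?_ ?_).elim
    fun C ⟨hC, h⟩ => ?_
  · exact UDef.ex (UDef.and (UDef.close UFun.one (UFun.sub (UFun.var 0) (UFun.var 2)) (UFun.var 4))
      (UDef.eq (UFun.comp₁ hF (UFun.var 0)) (UFun.var 1)))
  · rintro M p _ t t' l l' z z' y - hl ht - - ⟨x, h1, h2⟩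
    exact ⟨x, h1.trans (by simp) ht, h2⟩
  · exact ⟨fun M p => C M p 0, UDef.comp₃ (R := fun M x a b => x ∈ C M a b) hC (UFun.var 0)
      (UFun.var 1) UFun.zero, fun M p => h M p 0⟩

theorem exists_prepares_fiber (hT : IsHMinimal.{u, v, w} φ 1 T) :
    ∃ D : ∀ M : Mod.{u, v, w} φ T, M → Set M,
      (UDef fun (M : Mod.{u, v, w} φ T) (x : Fin 2 → M) => x 0 ∈ D M (x 1)) ∧
      ∀ (M : Mod.{u, v, w} φ T) (d : M),
        PreparesFamily M.O (D M d) fun x _ _ ζ => Close M.O 1 (F M x - d) ζ := by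
  refine (exists_preparesFamily hT
    (R := fun M x d _ _ _ ζ => Close M.O 1 (F M x - d) ζ) ?_ ?_).elim
    fun C ⟨hC, h⟩ => ?_
  · exact UDef.close UFun.one (UFun.sub (UFun.comp₁ hF (UFun.var 0)) (UFun.var 1)) (UFun.var 5)
  · intro M _ _ t t' l l' z z' x _ hl _ _ hz h
    exact h.trans (by simp) (hz.one hl)
  · exact ⟨fun M p => C M p 0, UDef.comp₃ (R := fun M x a b => x ∈ C M a b) hC (UFun.var 0)
      (UFun.var 1) UFun.zero, fun M p => h M p 0⟩

/-- The precision of the approximation depends only on `|t|`, so it enters as an `RV`-parameter `t`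
rather than as the level of preparation; one set `D` thus prepares all precisions at level `1`. -/
theorem exists_prepares_approxSlope (hT : IsHMinimal.{u, v, w} φ 1 T)
    {C : ∀ M : Mod.{u, v, w} φ T, Set M}
    (hC : UDef fun (M : Mod.{u, v, w} φ T) (x : Fin 1 → M) => x 0 ∈ C M)
    (M : Mod.{u, v, w} φ T) (p : M) :
    ∃ D : Set M, PreparesFamily M.O D fun y t _ _ => ApproxSlope M.O (F M) (C M) p t y := by
  refine (exists_preparesFamily hT
    (R := fun M y p _ t _ _ => ApproxSlope M.O (F M) (C M) p t y) ?_ ?_).elim fun D ⟨_, h⟩ => ?_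
  · refine UDef.all (UDef.imp ?_ (UDef.imp ?_ ?_))
    · exact UDef.not (UDef.eq (UFun.var 0) (UFun.var 2))
    · exact UDef.sameClass (C := fun M _ => C M) (UDef.comp₁ (R := fun M x => x ∈ C M) hC
        (UFun.var 0)) (UFun.var 4) (UFun.var 2) (UFun.var 0)
    · exact UDef.close (UFun.var 4) (UFun.mul (UFun.var 1) (UFun.sub (UFun.var 0) (UFun.var 2)))
        (UFun.sub (UFun.comp₁ hF (UFun.var 0)) (UFun.comp₁ hF (UFun.var 2)))
  · intro M _ _ t t' l l' z z' y _ hl ht _ _ h x hx hxx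
    have hv := ht.val_eq (by simp)
    rw [← close_iff_of_val_eq hv]
    exact h x hx (hxx.mono hv.ge)
  · exact ⟨D M p 0, h M p 0⟩

omit hF in
theorem IsNextTo.eq_class {K : Type w} [Field K] {O : ValuationSubring K} {m : Level O} {l : K}
    (hl : O.valuation l = ((m : (O.ValueGroup)ˣ) : O.ValueGroup)) {B C : Set K}
    (hB : IsNextTo m B C) {p : K} (hp : p ∈ B) : p ∉ C ∧ B = {x | SameClass O l C p x} := by
  obtain ⟨-, D, hD, rfl⟩ := hB
  simp only [Set.mem_iInter] at hp
  refine ⟨fun hpC => ?_, ?_⟩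
  · obtain ⟨-, ξ, hξ, hDξ⟩ := hD p hpC
    have := hp p hpC
    rw [hDξ, Set.mem_ofPred_eq, sub_self] at this
    exact hξ (by rw [← this]; simp [rv])
  · ext x
    simp only [Set.mem_iInter, Set.mem_ofPred_eq]
    refine forall₂_congr fun c hc => ?_
    obtain ⟨-, ξ, hξ, hDξ⟩ := hD c hc
    have := hp c hc
    rw [hDξ, Set.mem_ofPred_eq] at this ⊢
    rw [← rv_eq_iff m hl, this, eq_comm]

end Families

/-- The Jacobian property for `1`-h-minimal theories. -/
theorem jacobian_property {L : FirstOrder.Language.{u, v}} (φ : langVal →ᴸ L)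
    {K : Type (max u v w)} [Field K] [L.Structure K] (O : ValuationSubring K)
    (hK : IsValuedField φ O)
    (hmin : IsHMinimal.{u, v, w} φ 1 (L.completeTheory K))
    (f : K → K) (hf : (∅ : Set K).Definable₂ L {p : K × K | f p.1 = p.2}) :
    ∃ C : Set K, C.Finite ∧ C.Nonempty ∧ (∅ : Set K).Definable₁ L C ∧
      ∀ (l : Level O) (B : Set K), IsNextTo l B C →
        (∃ (f' : K → K) (ξ : RV l),
          (∀ x ∈ B, HasDeriv O f x (f' x)) ∧
          (∀ x ∈ B, rv l (f' x) = ξ) ∧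
          (∀ x₀ ∈ B, ∀ x ∈ B, x ≠ x₀ → rv l ((f x - f x₀) / (x - x₀)) = ξ)) ∧
        (∀ B' : Set K, IsOpenBall O B' → B' ⊆ B →
          (∃ y : K, f '' B' = {y}) ∨ IsOpenBall O (f '' B')) := by
  have hO : O ≠ ⊤ := hK.ne_top
  have : CharZero (IsLocalRing.ResidueField O) := hK.charZero_residueField
  have h11 : O.valuation (1 : K) ≤ 1 := by simp
  let M₀ : Mod.{u, v, w} φ (L.completeTheory K) := ⟨K, O, hK, inferInstance⟩
  obtain ⟨F, hF, hFf⟩ := exists_uFun M₀ f hf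
  obtain ⟨C₁, hC₁, hp₁⟩ := exists_prepares_secantAt hF hmin
  obtain ⟨C₂, hC₂, hp₂⟩ := exists_prepares_secantBall hF hmin
  obtain ⟨C₃, hC₃, hp₃⟩ := exists_prepares_imageDefect hF hmin
  obtain ⟨D, hD, hpD⟩ := exists_prepares_image hF hmin
  obtain ⟨E, hE, hpE⟩ := exists_prepares_fiber hF hmin
  let C₀ : ∀ M : Mod.{u, v, w} φ (L.completeTheory K), Set M := fun M => C₁ M ∪ C₂ M ∪ C₃ M
  have hC₀ : UDef fun (M : Mod.{u, v, w} φ (L.completeTheory K)) (x : Fin 1 → M) => x 0 ∈ C₀ M :=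
    (hC₁.or hC₂).or hC₃
  -- `C₀` controls slopes and defects. The added sets `E M d`, for `d ∈ D M c`, make `F` send each
  -- level-`1` class of `C` into one class of `D M c`, as required for balls reaching up to `c`.
  let C : ∀ M : Mod.{u, v, w} φ (L.completeTheory K), Set M := fun M =>
    {x | x ∈ C₀ M ∨ ∃ c, c ∈ C₀ M ∧ ∃ d, d ∈ D M c ∧ x ∈ E M d}
  have hC : UDef fun (M : Mod.{u, v, w} φ (L.completeTheory K)) (x : Fin 1 → M) => x 0 ∈ C M := by
    refine hC₀.or (UDef.ex (UDef.and ?_ (UDef.ex (UDef.and ?_ ?_))))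
    · exact UDef.comp₁ (R := fun M x => x ∈ C₀ M) hC₀ (UFun.var 0)
    · exact UDef.comp₂ (R := fun M x y => x ∈ D M y) hD (UFun.var 0) (UFun.var 1)
    · exact UDef.comp₂ (R := fun M x y => x ∈ E M y) hE (UFun.var 2) (UFun.var 0)
  have hC₀fin : (C₀ M₀).Finite := ((hp₁ M₀).1.union (hp₂ M₀).1).union (hp₃ M₀).1
  have hC₀C : C₀ M₀ ⊆ C M₀ := fun x hx => Or.inl hx
  have hCfin : (C M₀).Finite := by
    refine (hC₀fin.union (hC₀fin.biUnion fun c _ => (hpD M₀ c).1.biUnion fun d _ =>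
      (hpE M₀ d).1)).subset ?_
    rintro x (h | ⟨c, hc, d, hd, hx⟩)
    · exact Or.inl h
    · exact Or.inr (Set.mem_biUnion hc (Set.mem_biUnion hd hx))
  have hs₀ : ControlsSlopes O (F M₀) (C₀ M₀) :=
    ⟨(hp₁ M₀).mono (fun x hx => Or.inl (Or.inl hx)) hC₀fin,
      (hp₂ M₀).mono (fun x hx => Or.inl (Or.inr hx)) hC₀fin,
      fun z p => exists_prepares_linear hF hmin M₀ z p⟩
  have hs : ControlsSlopes O (F M₀) (C M₀) :=
    ⟨hs₀.secantAt.mono hC₀C hCfin, hs₀.secantBall.mono hC₀C hCfin, hs₀.exists_prep⟩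
  have hi₀ : PreparesFamily O (C₀ M₀) fun x t _ ζ => ImageDefect O (F M₀) x t ζ :=
    (hp₃ M₀).mono (fun x hx => Or.inr hx) hC₀fin
  have hCne : (C M₀).Nonempty := hs.secantAt.2.1
  have hder : ∀ p ∉ C M₀, ∃ a, ∀ l : K, l ≠ 0 → O.valuation l ≤ 1 →
      ApproxSlope O (F M₀) (C M₀) p l a := by
    intro p hp
    obtain ⟨W, hW⟩ := exists_prepares_approxSlope hF hmin hC M₀ p
    exact hs.exists_approxSlope hO hp hW
  choose! f' hf' using hder
  rw [hFf] at hf' hs hs₀ hi₀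
  refine ⟨C M₀, hCfin, hCne, UDef.definable₁ (P := fun M x => x ∈ C M) hC M₀, fun m B hB => ?_⟩
  obtain ⟨l, hl0, hl⟩ := exists_val_eq (O := O) (m : (O.ValueGroup)ˣ)
  have hl1 : O.valuation l ≤ 1 := hl ▸ m.val_le_one
  obtain ⟨p, hpB⟩ : B.Nonempty := hB.1.1.nonempty
  obtain ⟨hpC, hBp⟩ := hB.eq_class hl hpB
  have hnot : ∀ x ∈ B, x ∉ C M₀ := fun x hx => (hB.eq_class hl hx).1
  have hsame : ∀ x ∈ B, ∀ y ∈ B, SameClass O l (C M₀) x y := by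
    intro x hx y hy
    rw [(hB.eq_class hl hx).2] at hy
    exact hy
  -- The slope of this single secant supplies the constant leading term on `B`.
  obtain ⟨q, hqp, hq⟩ := exists_ne_sameClass hO hCfin hCne hpC hl0
  have hqB : q ∈ B := hBp ▸ hq
  set z := (f q - f p) / (q - p) with hz
  have hslope : ∀ x₀ ∈ B, ∀ x ∈ B, x ≠ x₀ → Close O l z ((f x - f x₀) / (x - x₀)) := by
    intro x₀ hx₀ x hx hne
    have hne' := sub_ne_zero.2 hne
    refine Close.cancel_right hne' ?_
    rw [div_mul_cancel₀ _ hne']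
    exact hs.close_slope hO hl0 hl1 hq hqp.symm (hsame p hpB x hx) (hsame p hpB x₀ hx₀) hne
  refine ⟨⟨f', rv m z, ?_, ?_, ?_⟩, ?_⟩
  · exact fun x hx => hasDeriv_of_approxSlope hCfin hCne (hnot x hx) (hf' x (hnot x hx))
  · intro x hx
    obtain ⟨y, hyx, hy⟩ := exists_ne_sameClass hO hCfin hCne (hnot x hx) hl0
    have hyB : y ∈ B := by rw [(hB.eq_class hl hx).2]; exact hy
    have hne' := sub_ne_zero.2 hyx
    have h1 := hf' x (hnot x hx) l hl0 hl1 y hyx hy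
    rw [rv_eq_iff m hl]
    refine Close.trans hl1 ?_ ((hslope x hx y hyB hyx).symm hl1)
    refine Close.cancel_right hne' ?_
    rwa [div_mul_cancel₀ _ hne']
  · intro x₀ hx₀ x hx hne
    rw [rv_eq_iff m hl]
    exact (hslope x₀ hx₀ x hx hne).symm hl1
  · intro B' hB' hBB'
    refine hs₀.image_isOpenBall hO hi₀ (D := D M₀) (fun c => ?_) hC₀C ?_ hpC hB'
      fun x hx => (hsame p hpB x (hBB' hx)).mono (by simpa using hl1)
    · rw [← hFf]; exact hpD M₀ c
    · intro c hc d hd ζ x x' hxx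
      rw [← hFf]
      exact (hpE M₀ d).2.2 0 1 ζ one_ne_zero h11 x x'
        (hxx.anti fun e he => Or.inr ⟨c, hc, d, hd, he⟩)

end HMin

end

theorem mainTheorem2 {L : FirstOrder.Language.{u, v}} (φ : HMin.langVal →ᴸ L)
    {K : Type (max u v w)} [Field K] [L.Structure K] (O : ValuationSubring K)
    (hK : HMin.IsValuedField φ O)
    (hmin : HMin.IsHMinimal.{u, v, w} φ 1 (L.completeTheory K))
    (f : K → K) (hf : (∅ : Set K).Definable₂ L {p : K × K | f p.1 = p.2}) :
    ∃ C : Set K, C.Finite ∧ C.Nonempty ∧ (∅ : Set K).Definable₁ L C ∧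
      ∀ (l : HMin.Level O) (B : Set K), HMin.IsNextTo l B C →
        (∃ (f' : K → K) (ξ : HMin.RV l),
          (∀ x ∈ B, HMin.HasDeriv O f x (f' x)) ∧
          (∀ x ∈ B, HMin.rv l (f' x) = ξ) ∧
          (∀ x₀ ∈ B, ∀ x ∈ B, x ≠ x₀ → HMin.rv l ((f x - f x₀) / (x - x₀)) = ξ)) ∧
        (∀ B' : Set K, HMin.IsOpenBall O B' → B' ⊆ B →
          (∃ y : K, f '' B' = {y}) ∨ HMin.IsOpenBall O (f '' B')) :=
  HMin.jacobian_property φ O hK hmin f hf
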